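/- Kac infinite chain. A microstate is a pair $(x,y)\in\{0,1\}^{\mathbb Z}\times\{0,1\}^{\mathbb Z}$. The dynamics is $\varphi(x,y)(i)=(x(i-1)+y(i-1)-2x(i-1)y(i-1),\,y(i))$, and the time reversal is $\pi(x,y)(i)=(x(-i),y(-i-1))$. For a macrostate $m=(m_0,m_1)\in[-1,1]\times[0,1]$ put $\Phi(m)=((1-2m_1)m_0,m_1)$, and let $\mu_m=\mu_{(1+m_0)/2}\times\mu_{m_1}$, where $\mu_p$ is the Bernoulli measure on $\{0,1\}^{\mathbb Z}$ with $\mu_p(x(i)=1)=p$. For $t\in\mathbb N$ let $\mu_{m,t}=\mu_m\varphi^{-t}$ and $(x_t,y_t)=\varphi^t(x,y)$. Configurations $x\in\{0,1\}^{\mathbb Z}$ are read as one-sided sequences $\iota(x)=x(0)x(-1)x(1)x(-2)x(2)\dots$; $x\upharpoonright n$ denotes the first $n$ bits of $\iota(x)$, and $[\sigma]$ is the set of the configurations whose one-sided sequence begins with $\sigma$. A microstate is Martin-Löf $\mu_m$-random if the binary sequence that interleaves $\iota(x)$ and $\iota(y)$ is Martin-Löf random with respect to the image of $\mu_m$. The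 rate of irreversible information loss is $$I_{\mu_m,t}(x,y)=\limsup_{n\to\infty}-\frac1n\ln\frac{\mu_{m,t}(\pi([x_t\upharpoonright n]\times[y_t\upharpoonright n]))}{\mu_{m,t}([x_t\upharpoonright n]\times[y_t\upharpoonright n])}\in[-\infty,\infty]\qquad(\ln 0=-\infty).$$ With $m_0^N(x,y)=\frac1{2N+1}\sum_{i=-N}^N(2x(i)-1)$, $m_1^N(x,y)=\frac1{2N+1}\sum_{i=-N}^N y(i)$ and $\lambda=\mu_{1/2}$, the Boltzmann entropy is $$S_B(m)=\lim_{\delta\downarrow0}\lim_{N\to\infty}\frac1{2N+1}\ln(\lambda\times\lambda)\left(\left\{(x,y):|m_0^N(x,y)-m_0|\le\delta,\ |m_1^N(x,y)-m_1|\le\delta\right\}\right).$$ Theorem. Let $m_0\in[-1,1]$ and $m_1\in[0,1]$ be computable reals, $t\in\mathbb N$, and let $(x,y)$ be Martin-Löf $\mu_m$-random. 1. If $|m_0|<1$, then $$I_{\mu_m,t}(x,y)=\frac{1-(1-2m_1)^{2t}}{2}\,m_0\ln\frac{1+m_0}{1-m_0}.$$ 2. If $m_0\ne0$, $m_1\notin\{0,1\}$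 and $t>0$, then $I_{\mu_m,t}(x,y)>0$. 3. The limits defining $S_B(m)$ and $S_B(\Phi^t(m))$ exist and are finite, and $I_{\mu_m,t}(x,y)\ge S_B(\Phi^t(m))-S_B(m)$, with equality if and only if $m_0=0$, $m_1\in\{0,1\}$ or $t=0$. -/

import Mathlib

open MeasureTheory Filter Topology

namespace KacChain

/-! ### Computability and Martin-Löf randomness on the Cantor space -/

/-- `x` is lower semicomputable: the set of rationals below `x` is computably enumerable.
Rationals are coded as `a / (b + 1)` with `a : ℤ`, `b : ℕ`. -/
def LowerSemicomputable (x : ℝ) : Prop :=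
  REPred fun q : ℤ × ℕ => (q.1 : ℝ) / ((q.2 : ℝ) + 1) < x

/-- Computable real numbers. -/
def ComputableReal (x : ℝ) : Prop :=
  LowerSemicomputable x ∧ LowerSemicomputable (-x)

/-- The cylinder `[σ]`: the infinite binary sequences with prefix `σ`. -/
def cylinder (σ : List Bool) : Set (ℕ → Bool) :=
  {x | ∀ (i : ℕ) (h : i < σ.length), x i = σ[i]}

/-- `(U n)` is a sequence of c.e. open sets, uniformly in `n`: there are sets of strings `S n`,
c.e. uniformly in `n`, with `U n = ⋃ σ ∈ S n, [σ]`. -/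
def UniformlyCEOpen (U : ℕ → Set (ℕ → Bool)) : Prop :=
  ∃ S : ℕ → Set (List Bool),
    (REPred fun p : ℕ × List Bool => p.2 ∈ S p.1) ∧ ∀ n, U n = ⋃ σ ∈ S n, cylinder σ

/-- Martin-Löf tests with respect to `μ`. -/
def IsMLTest (μ : Measure (ℕ → Bool)) (U : ℕ → Set (ℕ → Bool)) : Prop :=
  UniformlyCEOpen U ∧ ∀ n, μ (U n) ≤ (2⁻¹ : ENNReal) ^ n

/-- Martin-Löf randomness with respect to `μ` (used for computable `μ` only). -/
def IsMLRandom (μ : Measure (ℕ → Bool)) (x : ℕ → Bool) : Prop :=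
  ∀ U : ℕ → Set (ℕ → Bool), IsMLTest μ U → x ∉ ⋂ n, U n

/-! ### Microstates and their coding by binary sequences -/

/-- Configurations on the lattice `ℤ`. -/
abbrev Config : Type := ℤ → Bool

/-- A microstate `(x, y)`: `x i` says whether the spin at `i` is up, `y i` whether there is a
scatterer at `i`. -/
abbrev Microstate : Type := Config × Config

/-- The enumeration `0, -1, 1, -2, 2, …` of `ℤ`. -/
def site (n : ℕ) : ℤ := if Even n then ((n / 2 : ℕ) : ℤ) else -(((n + 1) / 2 : ℕ) : ℤ)

/-- `ι x = x(0) x(-1) x(1) x(-2) x(2) …`. -/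
def iota (x : Config) : ℕ → Bool := fun n => x (site n)

/-- `κ (u, v) = u(0) v(0) u(1) v(1) …`. -/
def kappa (u v : ℕ → Bool) : ℕ → Bool := fun n => if Even n then u (n / 2) else v (n / 2)

/-- The binary sequence which codes a microstate. -/
def code (z : Microstate) : ℕ → Bool := kappa (iota z.1) (iota z.2)

/-- Martin-Löf randomness of a microstate with respect to a measure on microstates. -/
def IsMLRandomState (μ : Measure Microstate) (z : Microstate) : Prop :=
  IsMLRandom (μ.map code) (code z)

/-! ### Dynamics, time reversal, Gibbs measures -/

/-- One time step: a particle moves from `i - 1` to `i`, and its spin is flipped if there is a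
scatterer at `i - 1`. On bits, `a + b - 2 a b` is `xor a b`. -/
def phi (z : Microstate) : Microstate :=
  (fun i => xor (z.1 (i - 1)) (z.2 (i - 1)), z.2)

/-- Time reversal. -/
def reversal (z : Microstate) : Microstate :=
  (fun i => z.1 (-i), fun i => z.2 (-i - 1))

/-- The Bernoulli measure on `{0, 1}^ℤ` with `P(x i = 1) = p`, for `p ∈ [0, 1]`
(outside `[0, 1]`, `p` is replaced by the nearest point of `[0, 1]`). -/
noncomputable def bernoulliConfig (p : ℝ) : Measure Config :=
  Measure.infinitePi fun _ : ℤ =>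
    ProbabilityTheory.bernoulliMeasure true false (Set.projIcc (0 : ℝ) 1 zero_le_one p)

/-- The Gibbs measure `μ_m` of the macrostate `m = (m₀, m₁) ∈ [-1, 1] × [0, 1]`. -/
noncomputable def gibbs (m : ℝ × ℝ) : Measure Microstate :=
  (bernoulliConfig ((1 + m.1) / 2)).prod (bernoulliConfig m.2)

/-- The macroscopic law `Φ`. -/
def Phi (m : ℝ × ℝ) : ℝ × ℝ := ((1 - 2 * m.2) * m.1, m.2)

/-! ### Irreversible information loss -/

/-- `[x ↾ n] × [y ↾ n]`, where `x` and `y` are read as one-sided sequences through `ι`. -/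
def window (z : Microstate) (n : ℕ) : Set Microstate :=
  {w | ∀ k < n, iota w.1 k = iota z.1 k ∧ iota w.2 k = iota z.2 k}

/-- The rate of irreversible information loss at time `t` of the microstate `z`, for the initial
measure `μ`, as an extended real number (with `ln 0 = -∞`):
`limsup_n -(1/n) ln (μ_t (π ([x_t ↾ n] × [y_t ↾ n])) / μ_t ([x_t ↾ n] × [y_t ↾ n]))`
where `μ_t` is the image of `μ` under `φ^t`, and `(x_t, y_t) = φ^t z`. -/
noncomputable def infoLoss (μ : Measure Microstate) (t : ℕ) (z : Microstate) : EReal :=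
  limsup (fun n : ℕ => ((-(1 / (n : ℝ)) : ℝ) : EReal) *
    ENNReal.log (μ.map phi^[t] (reversal '' window (phi^[t] z) n) /
      μ.map phi^[t] (window (phi^[t] z) n))) atTop

/-! ### Boltzmann entropy -/

/-- The magnetization `m₀^N` over the sites `-N, …, N`. -/
noncomputable def macro0 (N : ℕ) (z : Microstate) : ℝ :=
  (∑ i ∈ Finset.Icc (-(N : ℤ)) N, (if z.1 i then (1 : ℝ) else -1)) / (2 * N + 1)

/-- The density of scatterers `m₁^N` over the sites `-N, …, N`. -/
noncomputable def macro1 (N : ℕ) (z : Microstate) : ℝ :=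
  (∑ i ∈ Finset.Icc (-(N : ℤ)) N, (if z.2 i then (1 : ℝ) else 0)) / (2 * N + 1)

/-- The Boltzmann entropy of `m` exists and equals `S`: the inner limit `N → ∞` exists for each
`δ > 0`, and the outer limit `δ ↓ 0` exists and is `S`. The values are extended real numbers, with
`ln 0 = -∞`. -/
def HasBoltzmannEntropy (m : ℝ × ℝ) (S : EReal) : Prop :=
  ∃ L : ℝ → EReal,
    (∀ δ > 0, Tendsto (fun N : ℕ => ((1 / (2 * (N : ℝ) + 1) : ℝ) : EReal) *
        ENNReal.log (((bernoulliConfig (1 / 2)).prod (bernoulliConfig (1 / 2)))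
          {z | |macro0 N z - m.1| ≤ δ ∧ |macro1 N z - m.2| ≤ δ}))
      atTop (𝓝 (L δ))) ∧
    Tendsto L (𝓝[>] 0) (𝓝 S)

end KacChain

namespace KacChain

/-! ### Binomial coefficients and binary entropy -/

/-! A particle at site `i` at time `t` started at `i - t` and crossed the scatterers at `i - t, …, i
- 1`, so `φ^t` is explicit (`phi_iterate`). The Gibbs measure is a product measure, invariant under
separate permutations of the spin sites and the scatterer sites. After such a relabelling, the
preimages of the window and of its reversal become two instances of `event`. Both prescribe the
scatterers of `z`. The window prescribes the spins `x (i - t)`; the reversed window prescribes `x (i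
- t)` times the signs of the `2 t` scatterers from `i - t` on. Only at the at most `t` sites near
one edge can the prescription depend on scatterers outside the window, so for `|m₀| < 1` the
logarithm of each probability is a sum of Bernoulli log-weights up to a bounded error
(`gibbs_event_bounds`, `abs_log_gibbs_event_sub_le`).

The log-weight of a spin is affine in its sign. The logarithm of the ratio is therefore a constant
times a difference of sums of `block (2 * t)` and `block 0`, plus a bounded term. Blocks have mean
`-m₀ (1 - 2 m₁) ^ s` and are independent at distance greater than `s`. Chebyshev's inequality along
the squares turns their deviations into a Martin-Löf test (`IsMLRandom.eventually_not`), so a random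
microstate obeys the law of large numbers for blocks. This gives the formula, with a genuine limit
(`infoLoss_eq`).

In the remaining cases, if `t = 0` or `m₁ ∈ {0, 1}`, the two events have the same probability and
the rate is `0`. If `|m₀| = 1` and the scatterers are truly random, some site prescribes an
impossible spin and the rate is `⊤`.

The Boltzmann entropy is `H ((1 + m₀) / 2) + H m₁ - 2 log 2` with `H` the binary entropy. Gibbs'
inequality bounds the entropy gain strictly by the rate unless `m₀ = 0` or `|1 - 2 m₁| ^ t = 1`
(`binEntropy_sub_lt`). -/

lemma factorial_mul_pow_self_le (k j : ℕ) :
    k.factorial * k ^ j ≤ j.factorial * k ^ k := by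
  rcases le_total j k with h | h
  · obtain ⟨d, rfl⟩ := Nat.exists_eq_add_of_le h
    have h2 : (j + d).factorial ≤ j.factorial * (j + d) ^ d := by
      have := Nat.factorial_mul_ascFactorial j d
      rw [← this]
      exact Nat.mul_le_mul_left _ (Nat.ascFactorial_le_pow_add j d)
    calc (j + d).factorial * (j + d) ^ j ≤ j.factorial * (j + d) ^ d * (j + d) ^ j :=
          Nat.mul_le_mul_right _ h2
      _ = j.factorial * (j + d) ^ (j + d) := by ring
  · obtain ⟨d, rfl⟩ := Nat.exists_eq_add_of_le h
    have h2 : k.factorial * k ^ d ≤ (k + d).factorial :=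
      le_trans (Nat.mul_le_mul_left _ (Nat.pow_le_pow_left (Nat.le_succ k) d))
        Nat.factorial_mul_pow_le_factorial
    calc k.factorial * k ^ (k + d) = k.factorial * k ^ d * k ^ k := by ring
      _ ≤ _ := Nat.mul_le_mul_right _ h2

lemma choose_mul_pow_le (M k : ℕ) (hk : k ≤ M) :
    M.choose k * (k ^ k * (M - k) ^ (M - k)) ≤ M ^ M := by
  have h := add_pow k (M - k) M
  rw [Nat.add_sub_cancel' hk] at h
  conv_rhs => rw [h]
  refine le_trans (le_of_eq ?_) (Finset.single_le_sum
    (f := fun m => k ^ m * (M - k) ^ (M - m) * M.choose m) (fun _ _ => Nat.zero_le _)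
    (Finset.mem_range.2 (Nat.lt_succ_of_le hk)))
  ring

/-- Expand `(k + (M - k)) ^ M`: among the `M + 1` terms the one of index `k` is the largest, because
`k ^ j / j!` is maximal in `j` at `j = k`, and likewise for `M - k`. -/
lemma pow_le_succ_mul_choose (M k : ℕ) (hk : k ≤ M) :
    M ^ M ≤ (M + 1) * (M.choose k * (k ^ k * (M - k) ^ (M - k))) := by
  have h := add_pow k (M - k) M
  rw [Nat.add_sub_cancel' hk] at h
  conv_lhs => rw [h]
  have : ∀ j ∈ Finset.range (M + 1), k ^ j * (M - k) ^ (M - j) * ((M.choose j : ℕ) : ℕ) ≤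
      M.choose k * (k ^ k * (M - k) ^ (M - k)) := by
    intro j hj
    have hj : j ≤ M := Nat.lt_succ_iff.1 (Finset.mem_range.1 hj)
    have h1 := factorial_mul_pow_self_le k j
    have h2 := factorial_mul_pow_self_le (M - k) (M - j)
    have h3 := Nat.mul_le_mul h1 h2
    have e1 := Nat.choose_mul_factorial_mul_factorial hj
    have e2 := Nat.choose_mul_factorial_mul_factorial hk
    have p1 : 0 < j.factorial * (M - j).factorial * (k.factorial * (M - k).factorial) := by
      positivity
    refine Nat.le_of_mul_le_mul_left ?_ p1
    calc _ = (M.choose j * j.factorial * (M - j).factorial) *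
            ((k.factorial * k ^ j) * ((M - k).factorial * (M - k) ^ (M - j))) := by
            ring
      _ ≤ (M.choose j * j.factorial * (M - j).factorial) *
            ((j.factorial * k ^ k) * ((M - j).factorial * (M - k) ^ (M - k))) :=
            Nat.mul_le_mul_left _ h3
      _ = (M.choose k * k.factorial * (M - k).factorial) *
            ((j.factorial * k ^ k) * ((M - j).factorial * (M - k) ^ (M - k))) := by rw [e1, e2]
      _ = _ := by ring
  refine (Finset.sum_le_card_nsmul _ _ _ this).trans ?_
  simp

lemma log_pow_sub_log_pow (M k : ℕ) (hM : 0 < M) (hk : k ≤ M) :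
    Real.log ((M : ℝ) ^ M) - Real.log ((k : ℝ) ^ k * ((M - k : ℕ) : ℝ) ^ (M - k)) =
      M * Real.binEntropy (k / M) := by
  have hM' : (M : ℝ) ≠ 0 := by positivity
  have hpp : ∀ j : ℕ, (j : ℝ) ^ j ≠ 0 := by
    intro j
    rcases Nat.eq_zero_or_pos j with rfl | h
    · simp
    · positivity
  -- The conventions `0 ^ 0 = 1` and `log 0 = 0` make the identities hold at the endpoints `k = 0`
  -- and `k = M` too.
  have key : ∀ j : ℕ, (M : ℝ) * ((j : ℝ) / M).negMulLog = j * Real.log M - j * Real.log j := by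
    intro j
    rcases Nat.eq_zero_or_pos j with rfl | h
    · simp
    · have : (j : ℝ) ≠ 0 := by positivity
      rw [Real.negMulLog, Real.log_div this hM']
      field_simp
      ring
  rw [Real.log_mul (hpp _) (hpp _), Real.log_pow, Real.log_pow, Real.log_pow,
    Real.binEntropy_eq_negMulLog_add_negMulLog_one_sub]
  have e : (1 : ℝ) - k / M = ((M - k : ℕ) : ℝ) / M := by
    rw [Nat.cast_sub hk]; field_simp
  rw [e, mul_add, key, key, Nat.cast_sub hk]
  ring

lemma log_choose_le (M k : ℕ) (hM : 0 < M) (hk : k ≤ M) :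
    Real.log (M.choose k) ≤ M * Real.binEntropy (k / M) := by
  rw [← log_pow_sub_log_pow M k hM hk]
  have hc : 0 < (M.choose k : ℝ) := by exact_mod_cast Nat.choose_pos hk
  have hpp : ∀ j : ℕ, 0 < (j : ℝ) ^ j := by
    intro j
    rcases Nat.eq_zero_or_pos j with rfl | h
    · simp
    · positivity
  have := choose_mul_pow_le M k hk
  have h2 : (M.choose k : ℝ) * ((k : ℝ) ^ k * ((M - k : ℕ) : ℝ) ^ (M - k)) ≤ (M : ℝ) ^ M := by
    exact_mod_cast this
  have h3 := Real.log_le_log (by have := hpp k; have := hpp (M - k); positivity) h2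
  rw [Real.log_mul hc.ne' (mul_pos (hpp _) (hpp _)).ne'] at h3
  linarith

lemma le_log_choose (M k : ℕ) (hM : 0 < M) (hk : k ≤ M) :
    M * Real.binEntropy (k / M) - Real.log (M + 1) ≤ Real.log (M.choose k) := by
  rw [← log_pow_sub_log_pow M k hM hk]
  have hc : 0 < (M.choose k : ℝ) := by exact_mod_cast Nat.choose_pos hk
  have hpp : ∀ j : ℕ, 0 < (j : ℝ) ^ j := by
    intro j
    rcases Nat.eq_zero_or_pos j with rfl | h
    · simp
    · positivity
  have := pow_le_succ_mul_choose M k hk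
  have h2 : (M : ℝ) ^ M ≤
      (M + 1) * ((M.choose k : ℝ) * ((k : ℝ) ^ k * ((M - k : ℕ) : ℝ) ^ (M - k))) := by
    exact_mod_cast this
  have h3 := Real.log_le_log (hpp M) h2
  have hq := mul_pos (hpp k) (hpp (M - k))
  rw [Real.log_mul (by positivity) (by positivity), Real.log_mul hc.ne' hq.ne'] at h3
  linarith

/-! ### Asymptotics of binomial sums -/

/-- The uniform probability that the frequency of ones in `M` bits is within `δ` of `p`. -/
noncomputable def freqProb (p δ : ℝ) (M : ℕ) : ℝ :=
  (∑ k ∈ (Finset.range (M + 1)).filter (fun k : ℕ => |(k : ℝ) / M - p| ≤ δ),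
    (M.choose k : ℝ)) / 2 ^ M

/-- The maximum of the binary entropy over the points of `[0, 1]` within `δ` of `p`. -/
noncomputable def maxEntropy (p δ : ℝ) : ℝ :=
  sSup (Real.binEntropy '' (Set.Icc 0 1 ∩ Set.Icc (p - δ) (p + δ)))

lemma exists_maxEntropy {p δ : ℝ} (hp : p ∈ Set.Icc (0 : ℝ) 1) (hδ : 0 ≤ δ) :
    ∃ a ∈ Set.Icc (0 : ℝ) 1 ∩ Set.Icc (p - δ) (p + δ), maxEntropy p δ = Real.binEntropy a ∧
      ∀ b ∈ Set.Icc (0 : ℝ) 1 ∩ Set.Icc (p - δ) (p + δ),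
        Real.binEntropy b ≤ Real.binEntropy a := by
  have hc : IsCompact (Set.Icc (0 : ℝ) 1 ∩ Set.Icc (p - δ) (p + δ)) :=
    isCompact_Icc.inter isCompact_Icc
  obtain ⟨a, ha, h1, h2⟩ := hc.exists_sSup_image_eq_and_ge
    ⟨p, hp, by constructor <;> linarith⟩ Real.binEntropy_continuous.continuousOn
  exact ⟨a, ha, h1, h2⟩

lemma tendsto_maxEntropy {p : ℝ} (hp : p ∈ Set.Icc (0 : ℝ) 1) :
    Tendsto (maxEntropy p) (𝓝[>] 0) (𝓝 (Real.binEntropy p)) := by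
  rw [Metric.tendsto_nhdsWithin_nhds]
  intro ε hε
  obtain ⟨η, hη, h⟩ := Metric.continuous_iff.1 Real.binEntropy_continuous p ε hε
  refine ⟨η, hη, fun {δ} hδ hd => ?_⟩
  have hδ : 0 < δ := hδ
  rw [Real.dist_eq, sub_zero, abs_of_pos hδ] at hd
  obtain ⟨a, ⟨_, ha⟩, h1, h2⟩ := exists_maxEntropy hp hδ.le
  rw [h1]
  apply h
  rw [Real.dist_eq]
  have : |a - p| ≤ δ := abs_le.2 ⟨by linarith [ha.1], by linarith [ha.2]⟩
  linarith

/-- The point `a` may lie on the boundary of the `δ`-window around `p`, so `a * M` is rounded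
towards `p`: down if `p ≤ a`, up otherwise. Once `1 / M ≤ δ`, rounding cannot overshoot on the other
side of `p`. -/
lemma exists_freq_tendsto {p δ a : ℝ} (hδ : 0 < δ)
    (ha : a ∈ Set.Icc (0 : ℝ) 1 ∩ Set.Icc (p - δ) (p + δ)) :
    ∃ k : ℕ → ℕ, (∀ M, k M ≤ M) ∧ (∀ᶠ M : ℕ in atTop, |(k M : ℝ) / M - p| ≤ δ) ∧
      Tendsto (fun M : ℕ => (k M : ℝ) / M) atTop (𝓝 a) := by
  obtain ⟨⟨a0, a1⟩, a2, a3⟩ := ha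
  have hbig : ∀ᶠ M : ℕ in atTop, (0 : ℝ) < M ∧ 1 / (M : ℝ) ≤ δ := by
    have := tendsto_one_div_atTop_nhds_zero_nat (𝕜 := ℝ)
    filter_upwards [eventually_gt_atTop 0, this.eventually (eventually_le_nhds hδ)] with M h1 h2
    exact ⟨by exact_mod_cast h1, h2⟩
  by_cases hap : p ≤ a
  · refine ⟨fun M => ⌊a * M⌋₊, fun M => ?_, ?_, ?_⟩
    · exact Nat.floor_le_of_le (by nlinarith [(Nat.cast_nonneg M : (0 : ℝ) ≤ M)])
    · filter_upwards [hbig] with M hM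
      obtain ⟨h1, h2⟩ := hM
      have f1 := Nat.floor_le (mul_nonneg a0 h1.le)
      have f2 := Nat.lt_floor_add_one (a * M)
      have g1 : (⌊a * M⌋₊ : ℝ) / M ≤ a := by rw [div_le_iff₀ h1]; exact f1
      have g2 : a ≤ (⌊a * M⌋₊ : ℝ) / M + 1 / M := by
        rw [← add_div, le_div_iff₀ h1]; exact f2.le
      rw [abs_le]; constructor <;> linarith
    · exact (tendsto_nat_floor_mul_div_atTop a0).comp tendsto_natCast_atTop_atTop
  · refine ⟨fun M => ⌈a * M⌉₊, fun M => ?_, ?_, ?_⟩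
    · exact Nat.ceil_le.2 (by nlinarith [(Nat.cast_nonneg M : (0 : ℝ) ≤ M)])
    · filter_upwards [hbig] with M hM
      obtain ⟨h1, h2⟩ := hM
      have f1 := Nat.le_ceil (a * M)
      have f2 := Nat.ceil_lt_add_one (mul_nonneg a0 h1.le)
      have g1 : a ≤ (⌈a * M⌉₊ : ℝ) / M := by rw [le_div_iff₀ h1]; exact f1
      have g2 : (⌈a * M⌉₊ : ℝ) / M ≤ a + 1 / M := by
        rw [div_le_iff₀ h1, add_mul, one_div, inv_mul_cancel₀ h1.ne']; exact f2.le
      rw [abs_le]; constructor <;> linarith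
    · exact (tendsto_nat_ceil_mul_div_atTop a0).comp tendsto_natCast_atTop_atTop

lemma tendsto_log_succ_div : Tendsto (fun M : ℕ => Real.log (M + 1) / M) atTop (𝓝 0) := by
  have h1 : Tendsto (fun x : ℝ => Real.log x / x) atTop (𝓝 0) := by
    simpa using Real.tendsto_pow_log_div_mul_add_atTop 1 0 1 one_ne_zero
  have h2 : Tendsto (fun M : ℕ => ((M : ℝ) + 1)) atTop atTop :=
    tendsto_atTop_add_const_right _ _ tendsto_natCast_atTop_atTop
  have h3 : Tendsto (fun M : ℕ => ((M : ℝ) + 1) / M) atTop (𝓝 1) := by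
    have := (tendsto_one_div_atTop_nhds_zero_nat (𝕜 := ℝ)).const_add 1
    rw [add_zero] at this
    refine this.congr' ?_
    filter_upwards [eventually_gt_atTop 0] with M hM
    have : (M : ℝ) ≠ 0 := by positivity
    field_simp
  have := (h1.comp h2).mul h3
  rw [zero_mul] at this
  refine this.congr fun M => ?_
  have : (M : ℝ) + 1 ≠ 0 := by positivity
  simp only [Function.comp]
  field_simp

/-- Laplace's principle: the sum is at least one term whose frequency tends to the entropy maximizer
`a`, and at most `M + 1` times `exp (M * H a)`. The two bounds differ by `o(M)` on the logarithmic
scale. -/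
lemma freqProb_pos_tendsto {p δ : ℝ} (hp : p ∈ Set.Icc (0 : ℝ) 1) (hδ : 0 < δ) :
    (∀ᶠ M in atTop, 0 < freqProb p δ M) ∧
    Tendsto (fun M : ℕ => (1 / (M : ℝ)) * Real.log (freqProb p δ M)) atTop
      (𝓝 (maxEntropy p δ - Real.log 2)) := by
  obtain ⟨a, ha, h1, h2⟩ := exists_maxEntropy hp hδ.le
  obtain ⟨k, hk, hkδ, hka⟩ := exists_freq_tendsto hδ ha
  set s : ℕ → Finset ℕ := fun M =>
    (Finset.range (M + 1)).filter (fun k : ℕ => |(k : ℝ) / M - p| ≤ δ) with hs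
  set C : ℕ → ℝ := fun M => ∑ k ∈ s M, (M.choose k : ℝ) with hC
  have hCk : ∀ᶠ M in atTop, ((M.choose (k M) : ℕ) : ℝ) ≤ C M := by
    filter_upwards [hkδ] with M hM
    exact Finset.single_le_sum (f := fun k : ℕ => (M.choose k : ℝ)) (fun _ _ => by positivity)
      (Finset.mem_filter.2 ⟨Finset.mem_range.2 (Nat.lt_succ_of_le (hk M)), hM⟩)
  have hCpos : ∀ᶠ M in atTop, 0 < C M := by
    filter_upwards [hCk] with M hM
    exact lt_of_lt_of_le (by exact_mod_cast Nat.choose_pos (hk M)) hM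
  have hlog : ∀ᶠ M : ℕ in atTop, (1 / (M : ℝ)) * Real.log (freqProb p δ M) =
      Real.log (C M) / M - Real.log 2 := by
    filter_upwards [hCpos, eventually_gt_atTop 0] with M hM hM0
    have : (M : ℝ) ≠ 0 := by positivity
    have e : freqProb p δ M = C M / 2 ^ M := rfl
    rw [e, Real.log_div hM.ne' (by positivity), Real.log_pow]
    field_simp
  refine ⟨?_, ?_⟩
  · filter_upwards [hCpos] with M hM
    exact div_pos hM (by positivity)
  rw [tendsto_congr' hlog, h1]
  refine Tendsto.sub_const ?_ _
  have hlow : Tendsto (fun M : ℕ => Real.binEntropy ((k M : ℝ) / M) - Real.log (M + 1) / M) atTop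
      (𝓝 (Real.binEntropy a)) := by
    simpa using ((Real.binEntropy_continuous.tendsto a).comp hka).sub tendsto_log_succ_div
  have hup : Tendsto (fun M : ℕ => Real.binEntropy a + Real.log (M + 1) / M) atTop
      (𝓝 (Real.binEntropy a)) := by
    simpa using tendsto_log_succ_div.const_add (Real.binEntropy a)
  refine tendsto_of_tendsto_of_tendsto_of_le_of_le' hlow hup ?_ ?_
  · filter_upwards [hCk, eventually_gt_atTop 0] with M hM hM0
    have hM0' : (0 : ℝ) < M := by exact_mod_cast hM0
    have := le_log_choose M (k M) hM0 (hk M)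
    have h3 := Real.log_le_log (by exact_mod_cast Nat.choose_pos (hk M)) hM
    rw [le_div_iff₀ hM0', sub_mul, div_mul_cancel₀ _ hM0'.ne']
    linarith
  · filter_upwards [hCpos, eventually_gt_atTop 0] with M hM hM0
    have hM0' : (0 : ℝ) < M := by exact_mod_cast hM0
    have hb : C M ≤ (M + 1) * Real.exp (M * Real.binEntropy a) := by
      have : ∀ j ∈ s M, (M.choose j : ℝ) ≤ Real.exp (M * Real.binEntropy a) := by
        intro j hj
        obtain ⟨hj1, hj2⟩ := Finset.mem_filter.1 hj
        have hj1 : j ≤ M := Nat.lt_succ_iff.1 (Finset.mem_range.1 hj1)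
        have hc : 0 < (M.choose j : ℝ) := by exact_mod_cast Nat.choose_pos hj1
        rw [← Real.log_le_iff_le_exp hc]
        refine (log_choose_le M j hM0 hj1).trans (mul_le_mul_of_nonneg_left (h2 _ ?_) hM0'.le)
        rw [abs_le] at hj2
        refine ⟨⟨by positivity, ?_⟩, by linarith, by linarith⟩
        rw [div_le_one hM0']; exact_mod_cast hj1
      refine (Finset.sum_le_card_nsmul _ _ _ this).trans ?_
      rw [nsmul_eq_mul]
      refine mul_le_mul_of_nonneg_right ?_ (Real.exp_pos _).le
      have := Finset.card_filter_le (Finset.range (M + 1)) (fun k : ℕ => |(k : ℝ) / M - p| ≤ δ)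
      rw [Finset.card_range] at this
      exact_mod_cast this
    have h3 := Real.log_le_log hM hb
    rw [Real.log_mul (by positivity) (Real.exp_pos _).ne', Real.log_exp] at h3
    rw [div_le_iff₀ hM0', add_mul, div_mul_cancel₀ _ hM0'.ne']
    linarith

/-! ### Bernoulli measures -/

/-- The Bernoulli weight of a bit. -/
def weight (p : ℝ) (b : Bool) : ℝ := if b then p else 1 - p

lemma weight_nonneg {p : ℝ} (hp : p ∈ Set.Icc (0 : ℝ) 1) (b : Bool) : 0 ≤ weight p b := by
  obtain ⟨h0, h1⟩ := hp
  cases b <;> simp [weight, h0, h1]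

lemma weight_le_one {p : ℝ} (hp : p ∈ Set.Icc (0 : ℝ) 1) (b : Bool) : weight p b ≤ 1 := by
  obtain ⟨h0, h1⟩ := hp
  cases b <;> simp [weight, h0, h1]

/-- The Bernoulli measure on bits. -/
noncomputable def bernoulliBool (p : ℝ) : Measure Bool :=
  ProbabilityTheory.bernoulliMeasure true false (Set.projIcc (0 : ℝ) 1 zero_le_one p)

instance (p : ℝ) : IsProbabilityMeasure (bernoulliBool p) := by
  unfold bernoulliBool; infer_instance

lemma bernoulliConfig_eq (p : ℝ) :
    bernoulliConfig p = Measure.infinitePi fun _ : ℤ => bernoulliBool p := rfl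

instance (p : ℝ) : IsProbabilityMeasure (bernoulliConfig p) := by
  rw [bernoulliConfig_eq]; infer_instance

instance (m : ℝ × ℝ) : IsProbabilityMeasure (gibbs m) := by
  unfold gibbs; infer_instance

lemma bernoulliBool_singleton {p : ℝ} (hp : p ∈ Set.Icc (0 : ℝ) 1) (b : Bool) :
    bernoulliBool p {b} = ENNReal.ofReal (weight p b) := by
  have h : (bernoulliBool p).real {b} = weight p b := by
    rw [bernoulliBool, ProbabilityTheory.bernoulliMeasure_real_apply _ (measurableSet_singleton b)]
    rw [Set.projIcc_of_mem _ hp]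
    cases b <;> simp [weight]
  rw [← h, ofReal_measureReal]

lemma bernoulliConfig_cylinder {p : ℝ} (hp : p ∈ Set.Icc (0 : ℝ) 1) (W : Finset ℤ)
    (X : ℤ → Bool) :
    bernoulliConfig p {x | ∀ i ∈ W, x i = X i} =
      ENNReal.ofReal (∏ i ∈ W, weight p (X i)) := by
  have e : {x : ℤ → Bool | ∀ i ∈ W, x i = X i} = (W : Set ℤ).pi fun i => {X i} := by
    ext x; simp [Set.mem_pi]
  rw [e, bernoulliConfig_eq, Measure.infinitePi_pi _ (fun i _ => measurableSet_singleton _),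
    ENNReal.ofReal_prod_of_nonneg (fun i _ => weight_nonneg hp _)]
  exact Finset.prod_congr rfl fun i _ => bernoulliBool_singleton hp _

lemma measurableSet_cylinder (W : Finset ℤ) (X : ℤ → Bool) :
    MeasurableSet {x : ℤ → Bool | ∀ i ∈ W, x i = X i} := by
  have e : {x : ℤ → Bool | ∀ i ∈ W, x i = X i} = (W : Set ℤ).pi fun i => {X i} := by
    ext x; simp [Set.mem_pi]
  rw [e]
  exact MeasurableSet.pi W.countable_toSet fun i _ => measurableSet_singleton _

/-- The sign of a bit: `-1` for `true`, `1` for `false`. -/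
def sgn (b : Bool) : ℝ := if b then -1 else 1

lemma sgn_xor (a b : Bool) : sgn (xor a b) = sgn a * sgn b := by
  cases a <;> cases b <;> simp [sgn]

lemma abs_sgn (b : Bool) : |sgn b| = 1 := by cases b <;> simp [sgn]

lemma integral_sgn {p : ℝ} (hp : p ∈ Set.Icc (0 : ℝ) 1) :
    ∫ b, sgn b ∂bernoulliBool p = 1 - 2 * p := by
  rw [integral_fintype (Integrable.of_finite)]
  simp only [Fintype.sum_bool, measureReal_def, bernoulliBool_singleton hp,
    ENNReal.toReal_ofReal (weight_nonneg hp _)]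
  simp [weight, sgn]; ring

lemma integral_prod_sgn {p : ℝ} (hp : p ∈ Set.Icc (0 : ℝ) 1) (A : Finset ℤ) :
    ∫ x, ∏ i ∈ A, sgn (x i) ∂bernoulliConfig p = (1 - 2 * p) ^ A.card := by
  have e : ∀ x : Config, ∏ i ∈ A, sgn (x i) =
      (fun y : (i : A) → Bool => ∏ i, sgn (y i)) (A.restrict x) := by
    intro x; rw [← Finset.prod_coe_sort]; rfl
  rw [bernoulliConfig_eq, integral_congr_ae (ae_of_all _ e)]
  refine (integral_restrict_infinitePi (μ := fun _ : ℤ => bernoulliBool p) (s := A)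
    (f := fun y : (i : A) → Bool => ∏ i, sgn (y i))
    (Measurable.of_discrete).aestronglyMeasurable).trans ?_
  rw [integral_fintype_prod_eq_prod (f := fun (_ : A) b => sgn b)]
  simp [integral_sgn hp]

/-! ### Boltzmann entropy of a Bernoulli macrostate -/

/-- The number of ones of `x` in `I`. -/
def ones (I : Finset ℤ) (x : Config) : ℕ := (I.filter fun i => x i = true).card

lemma half_mem : (1 / 2 : ℝ) ∈ Set.Icc (0 : ℝ) 1 := by constructor <;> norm_num

lemma bernoulliConfig_half_ones (I : Finset ℤ) (P : ℕ → Prop) [DecidablePred P] :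
    bernoulliConfig (1 / 2) {x | P (ones I x)} =
      ENNReal.ofReal
        ((∑ k ∈ (Finset.range (I.card + 1)).filter P, (I.card.choose k : ℝ)) / 2 ^ I.card) := by
  -- Split according to the set `A` of ones in `I`; the pieces are disjoint cylinders, each of mass
  -- `2 ^ (-|I|)`.
  have e : {x : Config | P (ones I x)} = ⋃ A ∈ I.powerset.filter (fun A => P A.card),
      {x : Config | ∀ i ∈ I, x i = decide (i ∈ A)} := by
    ext x
    simp only [Set.mem_ofPred_eq, Set.mem_iUnion, Finset.mem_filter, Finset.mem_powerset, exists_prop]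
    constructor
    · intro h
      refine ⟨I.filter fun i => x i = true, ⟨Finset.filter_subset _ _, h⟩, fun i hi => ?_⟩
      simp [hi]
    · rintro ⟨A, ⟨hA, hP⟩, h⟩
      have : I.filter (fun i => x i = true) = A := by
        ext i
        simp only [Finset.mem_filter]
        constructor
        · rintro ⟨hi, hx⟩
          rw [h i hi] at hx; simpa using hx
        · intro hi
          exact ⟨hA hi, by rw [h i (hA hi)]; simpa using hi⟩
      rw [ones, this]; exact hP
  rw [e, measure_biUnion_finset]
  · have hw : ∀ A ∈ I.powerset.filter (fun A => P A.card),
        bernoulliConfig (1 / 2) {x : Config | ∀ i ∈ I, x i = decide (i ∈ A)} =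
          ENNReal.ofReal (1 / 2 ^ I.card) := by
      intro A _
      rw [bernoulliConfig_cylinder half_mem]
      congr 1
      have : ∀ b, weight (1 / 2) b = 1 / 2 := by intro b; cases b <;> norm_num [weight]
      simp only [this, Finset.prod_const]
      rw [div_pow, one_pow]
    rw [Finset.sum_congr rfl hw, ← ENNReal.ofReal_sum_of_nonneg (fun _ _ => by positivity)]
    congr 1
    rw [Finset.sum_div, Finset.sum_filter, Finset.sum_powerset, Finset.sum_filter]
    refine Finset.sum_congr rfl fun k _ => ?_
    rw [Finset.sum_congr rfl (g := fun _ => if P k then (1 : ℝ) / 2 ^ I.card else 0)]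
    · rw [Finset.sum_const, Finset.card_powersetCard, nsmul_eq_mul]
      split_ifs <;> ring
    · intro A hA
      rw [(Finset.mem_powersetCard.1 hA).2]
  · intro A hA B hB hAB
    refine Set.disjoint_left.2 fun x hx hx' => hAB ?_
    have hA := (Finset.mem_powerset.1 (Finset.mem_filter.1 hA).1)
    have hB := (Finset.mem_powerset.1 (Finset.mem_filter.1 hB).1)
    ext i
    by_cases hi : i ∈ I
    · have := (hx i hi).symm.trans (hx' i hi)
      simpa using this
    · exact ⟨fun h => absurd (hA h) hi, fun h => absurd (hB h) hi⟩
  · intro A _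
    exact measurableSet_cylinder I fun i => decide (i ∈ A)

lemma card_box (N : ℕ) : (Finset.Icc (-(N : ℤ)) N).card = 2 * N + 1 := by
  rw [Int.card_Icc]; omega

lemma macro1_eq (N : ℕ) (z : Microstate) :
    macro1 N z = (ones (Finset.Icc (-(N : ℤ)) N) z.2 : ℝ) / ((2 * N + 1 : ℕ) : ℝ) := by
  rw [macro1, ones, Finset.card_filter]
  push_cast
  rfl

lemma macro0_eq (N : ℕ) (z : Microstate) :
    macro0 N z = 2 * ((ones (Finset.Icc (-(N : ℤ)) N) z.1 : ℝ) / ((2 * N + 1 : ℕ) : ℝ)) - 1 := by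
  have h : ∀ i, (if z.1 i then (1 : ℝ) else -1) = 2 * (if z.1 i then 1 else 0) - 1 := by
    intro i; split_ifs <;> norm_num
  rw [macro0, ones, Finset.card_filter]
  simp_rw [h]
  rw [Finset.sum_sub_distrib, ← Finset.mul_sum, Finset.sum_const, card_box]
  push_cast
  have : (2 * (N : ℝ) + 1) ≠ 0 := by positivity
  field_simp
  rw [nsmul_eq_mul]
  push_cast
  ring

lemma hasBoltzmannEntropy {m : ℝ × ℝ} (h0 : m.1 ∈ Set.Icc (-1 : ℝ) 1)
    (h1 : m.2 ∈ Set.Icc (0 : ℝ) 1) :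
    HasBoltzmannEntropy m ((Real.binEntropy ((1 + m.1) / 2) + Real.binEntropy m.2 -
      2 * Real.log 2 : ℝ) : EReal) := by
  have hp : (1 + m.1) / 2 ∈ Set.Icc (0 : ℝ) 1 := by
    obtain ⟨a, b⟩ := h0; constructor <;> linarith
  set p := (1 + m.1) / 2 with hpdef
  -- The magnetization is `2 f - 1` for the frequency `f` of up spins, so a tolerance `δ` for it is
  -- a tolerance `δ / 2` for `f`.
  refine ⟨fun δ => (((maxEntropy p (δ / 2) - Real.log 2) +
    (maxEntropy m.2 δ - Real.log 2) : ℝ) : EReal), ?_, ?_⟩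
  · intro δ hδ
    obtain ⟨pos0, lim0⟩ := freqProb_pos_tendsto hp (half_pos hδ)
    obtain ⟨pos1, lim1⟩ := freqProb_pos_tendsto h1 hδ
    have hodd : Tendsto (fun N : ℕ => 2 * N + 1) atTop atTop :=
      tendsto_atTop_mono (fun N => by rw [id]; omega) tendsto_id
    have lim := ((lim0.comp hodd).add (lim1.comp hodd))
    refine Tendsto.congr' ?_ ((continuous_coe_real_ereal.tendsto _).comp lim)
    filter_upwards [hodd.eventually pos0, hodd.eventually pos1] with N hN0 hN1
    have hset : {z : Microstate | |macro0 N z - m.1| ≤ δ ∧ |macro1 N z - m.2| ≤ δ} =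
        {x : Config | |(ones (Finset.Icc (-(N : ℤ)) N) x : ℝ) / ((2 * N + 1 : ℕ) : ℝ) - p| ≤ δ / 2}
        ×ˢ {y : Config |
          |(ones (Finset.Icc (-(N : ℤ)) N) y : ℝ) / ((2 * N + 1 : ℕ) : ℝ) - m.2| ≤ δ} := by
      ext z
      simp only [Set.mem_ofPred_eq, Set.mem_prod, macro0_eq, macro1_eq]
      refine and_congr_left fun _ => ?_
      rw [abs_le, abs_le, hpdef]
      constructor <;> rintro ⟨a, b⟩ <;> constructor <;> linarith
    classical
    have e0 := bernoulliConfig_half_ones (Finset.Icc (-(N : ℤ)) N)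
      (fun k => |(k : ℝ) / ((2 * N + 1 : ℕ) : ℝ) - p| ≤ δ / 2)
    have e1 := bernoulliConfig_half_ones (Finset.Icc (-(N : ℤ)) N)
      (fun k => |(k : ℝ) / ((2 * N + 1 : ℕ) : ℝ) - m.2| ≤ δ)
    rw [card_box] at e0 e1
    have f0 : bernoulliConfig (1 / 2) {x : Config |
        |(ones (Finset.Icc (-(N : ℤ)) N) x : ℝ) / ((2 * N + 1 : ℕ) : ℝ) - p| ≤ δ / 2} =
        ENNReal.ofReal (freqProb p (δ / 2) (2 * N + 1)) := by
      rw [e0, freqProb]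
    have f1 : bernoulliConfig (1 / 2) {x : Config |
        |(ones (Finset.Icc (-(N : ℤ)) N) x : ℝ) / ((2 * N + 1 : ℕ) : ℝ) - m.2| ≤ δ} =
        ENNReal.ofReal (freqProb m.2 δ (2 * N + 1)) := by
      rw [e1, freqProb]
    rw [hset, Measure.prod_prod, f0, f1, ← ENNReal.ofReal_mul hN0.le,
      ENNReal.log_ofReal_of_pos (mul_pos hN0 hN1), Real.log_mul hN0.ne' hN1.ne', ← EReal.coe_mul]
    simp only [Function.comp]
    congr 1
    push_cast
    ring
  · refine (continuous_coe_real_ereal.tendsto _).comp ?_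
    have l0 : Tendsto (fun δ : ℝ => maxEntropy p (δ / 2)) (𝓝[>] 0) (𝓝 (Real.binEntropy p)) := by
      refine (tendsto_maxEntropy hp).comp ?_
      refine tendsto_nhdsWithin_iff.2 ⟨?_, ?_⟩
      · have : Tendsto (fun δ : ℝ => δ / 2) (𝓝 0) (𝓝 (0 / 2)) :=
          (continuous_id.div_const 2).tendsto 0
        rw [zero_div] at this
        exact this.mono_left nhdsWithin_le_nhds
      · filter_upwards [self_mem_nhdsWithin] with δ hδ
        exact half_pos (Set.mem_Ioi.1 hδ)
    have := (l0.sub_const (Real.log 2)).add ((tendsto_maxEntropy h1).sub_const (Real.log 2))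
    convert this using 2
    ring

/-! ### Laws of large numbers for Martin-Löf random sequences -/

/-- The exclusive or of the bits `u (4 j + d)`, `d ∈ D`. -/
def xorAt (D : List ℕ) (u : ℕ → Bool) (j : ℕ) : Bool :=
  D.foldr (fun d b => xor (u (4 * j + d)) b) false

/-- The number of `j < N` with `xorAt D u j = true`. -/
def xorCount (D : List ℕ) (u : ℕ → Bool) (N : ℕ) : ℕ :=
  Nat.rec 0 (fun j c => c + (xorAt D u j).toNat) N

lemma xorCount_eq_sum (D : List ℕ) (u : ℕ → Bool) (N : ℕ) :
    xorCount D u N = ∑ j ∈ Finset.range N, (xorAt D u j).toNat := by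
  induction N with
  | zero => rfl
  | succ N ih => rw [Finset.sum_range_succ, ← ih]; rfl

lemma primrec_xorAt (D : List ℕ) :
    Primrec fun p : List Bool × ℕ => xorAt D (fun i => p.1.getD i false) p.2 := by
  induction D with
  | nil => exact Primrec.const false
  | cons d D ih =>
    have h : Primrec fun p : List Bool × ℕ => p.1.getD (4 * p.2 + d) false :=
      (Primrec.list_getD false).comp Primrec.fst
        (Primrec.nat_add.comp (Primrec.nat_mul.comp (Primrec.const 4) Primrec.snd)
          (Primrec.const d))
    exact (Primrec.dom_bool₂ xor).comp h ih

lemma primrec_xorCount (D : List ℕ) :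
    Primrec₂ fun (σ : List Bool) (N : ℕ) => xorCount D (fun i => σ.getD i false) N := by
  refine Primrec.nat_rec (f := fun _ : List Bool => 0)
    (g := fun σ p => p.2 + (xorAt D (fun i => σ.getD i false) p.1).toNat) (Primrec.const 0) ?_
  refine Primrec.nat_add.comp (Primrec.snd.comp Primrec.snd)
    ((Primrec.dom_bool Bool.toNat).comp ?_)
  exact (primrec_xorAt D).comp (Primrec.fst.pair (Primrec.fst.comp Primrec.snd))

lemma primrec_two_pow : Primrec fun n : ℕ => 2 ^ n := by
  have h : Primrec fun n : ℕ => (Nat.rec 1 (fun _ c => 2 * c) n : ℕ) :=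
    Primrec.nat_rec₁ 1 (Primrec.nat_mul.comp (Primrec.const 2) Primrec.snd)
  refine h.of_eq fun n => ?_
  induction n with
  | zero => rfl
  | succ n ih => rw [pow_succ, ← ih]; exact mul_comm _ _

lemma xorAt_congr {D : List ℕ} {u v : ℕ → Bool} {j : ℕ} (h : ∀ d ∈ D, u (4 * j + d) = v (4 * j + d)) :
    xorAt D u j = xorAt D v j := by
  induction D with
  | nil => rfl
  | cons d D ih =>
    have h1 := ih fun d hd => h d (List.mem_cons_of_mem _ hd)
    have h2 := h d List.mem_cons_self
    simp only [xorAt, List.foldr_cons] at h1 ⊢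
    rw [h1, h2]

lemma xorCount_congr {D : List ℕ} {u v : ℕ → Bool} {e N : ℕ} (hD : ∀ d ∈ D, d ≤ e)
    (h : ∀ i < (4 + e) * N, u i = v i) : xorCount D u N = xorCount D v N := by
  rw [xorCount_eq_sum, xorCount_eq_sum]
  refine Finset.sum_congr rfl fun j hj => ?_
  rw [xorAt_congr fun d hd => h _ ?_]
  have h1 := Finset.mem_range.1 hj
  have h2 := hD d hd
  nlinarith

lemma getD_of_mem_cylinder {σ : List Bool} {u : ℕ → Bool} (hu : u ∈ cylinder σ) {i : ℕ}
    (hi : i < σ.length) : σ.getD i false = u i := by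
  rw [hu i hi, List.getD_eq_getElem _ _ hi]

/-- The first `n` bits of a sequence. -/
def prefixList (u : ℕ → Bool) (n : ℕ) : List Bool := (List.range n).map u

lemma mem_cylinder_prefixList (u : ℕ → Bool) (n : ℕ) : u ∈ cylinder (prefixList u n) := by
  intro i hi
  simp [prefixList]

/-- If the sets of sequences for which the count at `k ^ 2` is in the primitive recursive relation
`R` to `k` have measure `O(1 / k ^ 2)`, a random sequence is in finitely many of them. -/
lemma IsMLRandom.eventually_not {ν : Measure (ℕ → Bool)} {u : ℕ → Bool} (hu : IsMLRandom ν u)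
    (D : List ℕ) {R : ℕ → ℕ → Prop} (hR : PrimrecRel R) {B : ℝ} (hB : 0 ≤ B)
    (hν : ∀ k : ℕ, 0 < k → ν {v | R k (xorCount D v (k ^ 2))} ≤ ENNReal.ofReal (B / k ^ 2)) :
    ∀ᶠ k in atTop, ¬ R k (xorCount D u (k ^ 2)) := by
  obtain ⟨e, he⟩ : ∃ e, ∀ d ∈ D, d ≤ e := ⟨D.sum, fun d hd => List.le_sum_of_mem hd⟩
  -- The tail of `∑ B / k ^ 2` from `K * 2 ^ n` on is at most `2 * B / (K * 2 ^ n)`, hence at most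
  -- `2 ^ (-n)` when `2 * B ≤ K`; `1 ≤ K` keeps the starting index positive.
  obtain ⟨K, hK⟩ := exists_nat_ge (max 1 (2 * B))
  have hK1 : (1 : ℝ) ≤ K := (le_max_left _ _).trans hK
  have hK2 : 2 * B ≤ K := (le_max_right _ _).trans hK
  -- The count at `k ^ 2` reads only bits of index below `(4 + e) * k ^ 2`. Hence `f σ` is a `k` for
  -- which `σ` already decides the count, and the padding of `σ` by `false` is never read.
  let f : List Bool → ℕ := fun σ => Nat.sqrt (σ.length / (4 + e))
  let S : ℕ → Set (List Bool) := fun n =>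
    {σ | K * 2 ^ n ≤ f σ ∧ R (f σ) (xorCount D (fun i => σ.getD i false) (f σ * f σ))}
  have hf : Primrec f :=
    Primrec.nat_sqrt.comp (Primrec.nat_div.comp Primrec.list_length (Primrec.const _))
  have hS : REPred fun p : ℕ × List Bool => p.2 ∈ S p.1 := by
    refine ComputablePred.to_re (PrimrecPred.computablePred ?_)
    have hf2 : Primrec fun p : ℕ × List Bool => f p.2 := hf.comp Primrec.snd
    refine PrimrecPred.and ?_ ?_
    · exact Primrec.nat_le.comp (Primrec.nat_mul.comp (Primrec.const K)
        (primrec_two_pow.comp Primrec.fst)) hf2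
    · exact hR.comp hf2 ((primrec_xorCount D).comp Primrec.snd (Primrec.nat_mul.comp hf2 hf2))
  have hcount : ∀ σ : List Bool, ∀ v ∈ cylinder σ,
      xorCount D (fun i => σ.getD i false) (f σ * f σ) = xorCount D v (f σ ^ 2) := by
    intro σ v hv
    rw [sq]
    refine xorCount_congr he fun i hi => getD_of_mem_cylinder hv (lt_of_lt_of_le hi ?_)
    have h1 : f σ * f σ ≤ σ.length / (4 + e) := Nat.sqrt_le _
    exact (Nat.mul_le_mul_left _ h1).trans (Nat.mul_div_le _ _)
  let U : ℕ → Set (ℕ → Bool) := fun n => ⋃ σ ∈ S n, cylinder σ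
  have htest : IsMLTest ν U := by
    refine ⟨⟨S, hS, fun n => rfl⟩, fun n => ?_⟩
    have hsub : U n ⊆ ⋃ i : ℕ,
        {v | R (K * 2 ^ n + i) (xorCount D v ((K * 2 ^ n + i) ^ 2))} := by
      intro v hv
      obtain ⟨σ, hσ, hv⟩ := Set.mem_iUnion₂.1 hv
      obtain ⟨h1, h2⟩ := hσ
      rw [hcount σ v hv] at h2
      obtain ⟨i, hi⟩ := Nat.exists_eq_add_of_le h1
      rw [hi] at h2
      exact Set.mem_iUnion.2 ⟨i, h2⟩
    have hpos : 0 < K * 2 ^ n :=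
      Nat.mul_pos (by exact_mod_cast lt_of_lt_of_le one_pos hK1) (by positivity)
    refine (measure_mono hsub).trans ((measure_iUnion_le _).trans ?_)
    have hpw : (2⁻¹ : ENNReal) ^ n = ENNReal.ofReal ((1 / 2) ^ n) := by
      rw [ENNReal.ofReal_pow (by norm_num), one_div, ENNReal.ofReal_inv_of_pos two_pos]
      norm_num
    rw [hpw]
    refine (ENNReal.tsum_le_tsum fun i => hν (K * 2 ^ n + i) (by omega)).trans ?_
    refine ENNReal.tsum_le_of_sum_range_le fun m => ?_
    rw [← ENNReal.ofReal_sum_of_nonneg fun i _ => by positivity]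
    refine ENNReal.ofReal_le_ofReal ?_
    have hsum : ∑ i ∈ Finset.range m, B / (((K * 2 ^ n + i : ℕ) : ℝ)) ^ 2 ≤
        2 * B * (1 / ((K * 2 ^ n : ℕ) : ℝ) - 1 / ((K * 2 ^ n + m : ℕ) : ℝ)) := by
      induction m with
      | zero => simp
      | succ m ih =>
        rw [Finset.sum_range_succ]
        have hx : (1 : ℝ) ≤ ((K * 2 ^ n + m : ℕ) : ℝ) := by exact_mod_cast (by omega)
        have e1 : ((K * 2 ^ n + (m + 1) : ℕ) : ℝ) = ((K * 2 ^ n + m : ℕ) : ℝ) + 1 := by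
          push_cast; ring
        rw [e1]
        generalize ((K * 2 ^ n + m : ℕ) : ℝ) = x at *
        have hx0 : 0 < x := by linarith
        -- Telescoping bound: `1 / x ^ 2 ≤ 2 / (x * (x + 1))` for `x ≥ 1`.
        have h3 : B / x ^ 2 ≤ 2 * B * (1 / x - 1 / (x + 1)) := by
          have : 2 * B * (1 / x - 1 / (x + 1)) - B / x ^ 2 = B * (x - 1) / (x ^ 2 * (x + 1)) := by
            field_simp; ring
          have h4 : 0 ≤ B * (x - 1) / (x ^ 2 * (x + 1)) :=
            div_nonneg (mul_nonneg hB (by linarith)) (by positivity)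
          linarith
        linarith
    refine hsum.trans ?_
    calc 2 * B * (1 / ((K * 2 ^ n : ℕ) : ℝ) - 1 / ((K * 2 ^ n + m : ℕ) : ℝ))
        ≤ 2 * B * (1 / ((K * 2 ^ n : ℕ) : ℝ)) := by
          refine mul_le_mul_of_nonneg_left ?_ (by positivity)
          have : 0 ≤ 1 / ((K * 2 ^ n + m : ℕ) : ℝ) := by positivity
          linarith
      _ = (2 * B / K) * (1 / 2) ^ n := by
          push_cast
          rw [div_pow, one_pow]
          field_simp
      _ ≤ 1 * (1 / 2) ^ n := by
          refine mul_le_mul_of_nonneg_right ?_ (by positivity)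
          rw [div_le_one (by linarith)]; exact hK2
      _ = _ := one_mul _
  have hnot := hu U htest
  simp only [Set.mem_iInter, not_forall] at hnot
  obtain ⟨n, hn⟩ := hnot
  filter_upwards [eventually_ge_atTop (K * 2 ^ n)] with k hk hRk
  -- The prefix length is chosen so that `f` takes exactly the value `k`.
  refine hn (Set.mem_iUnion₂.2 ⟨prefixList u ((4 + e) * (k * k)), ?_,
    mem_cylinder_prefixList _ _⟩)
  have hfk : f (prefixList u ((4 + e) * (k * k))) = k := by
    simp only [f, prefixList, List.length_map, List.length_range]
    rw [Nat.mul_div_cancel_left _ (by omega), Nat.sqrt_eq]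
  refine ⟨by rw [hfk]; exact hk, ?_⟩
  rw [hcount _ u (mem_cylinder_prefixList _ _), hfk]
  exact hRk

lemma measurable_xorAt (D : List ℕ) (j : ℕ) : Measurable fun u : ℕ → Bool => xorAt D u j := by
  induction D with
  | nil => exact measurable_const
  | cons d D ih =>
    have h : Measurable fun p : Bool × Bool => xor p.1 p.2 := Measurable.of_discrete
    exact h.comp ((measurable_pi_apply (4 * j + d)).prodMk ih)

lemma measurable_xorCount (D : List ℕ) (N : ℕ) :
    Measurable fun u : ℕ → Bool => xorCount D u N := by
  simp_rw [xorCount_eq_sum]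
  exact Finset.measurable_sum _ fun j _ =>
    (Measurable.of_discrete (f := Bool.toNat)).comp (measurable_xorAt D j)

lemma xorCount_le (D : List ℕ) (u : ℕ → Bool) (N : ℕ) : xorCount D u N ≤ N := by
  rw [xorCount_eq_sum]
  refine (Finset.sum_le_card_nsmul _ _ 1 fun j _ => Bool.toNat_le _).trans ?_
  simp

/-- Chebyshev's inequality at `N = k ^ 2`: a second moment of at most `C * k ^ 2` against the
threshold `(η * k ^ 2) ^ 2`. Sampling at squares makes the bounds summable. -/
lemma measure_deviation_le {ν : Measure (ℕ → Bool)} [IsProbabilityMeasure ν] (D : List ℕ)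
    {ρ C η : ℝ} (hη : 0 < η)
    (hvar : ∀ N : ℕ, ∫ v, ((xorCount D v N : ℝ) - ρ * N) ^ 2 ∂ν ≤ C * N) (k : ℕ) (hk : 0 < k)
    {s : Set (ℕ → Bool)}
    (hs : ∀ v ∈ s, η * (k : ℝ) ^ 2 ≤ |(xorCount D v (k ^ 2) : ℝ) - ρ * (k : ℝ) ^ 2|) :
    ν s ≤ ENNReal.ofReal (C / η ^ 2 / k ^ 2) := by
  have hk' : (0 : ℝ) < k := by exact_mod_cast hk
  set g : (ℕ → Bool) → ℝ := fun v => ((xorCount D v (k ^ 2) : ℝ) - ρ * (k ^ 2 : ℕ)) ^ 2 with hg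
  have hmeas : Measurable g :=
    (((Measurable.of_discrete (f := fun n : ℕ => (n : ℝ))).comp
      (measurable_xorCount D _)).sub_const _).pow_const 2
  have hint : Integrable g ν := by
    refine Integrable.of_bound hmeas.aestronglyMeasurable
      ((((k ^ 2 : ℕ) : ℝ) + |ρ * (k ^ 2 : ℕ)|) ^ 2) (ae_of_all _ fun v => ?_)
    rw [Real.norm_eq_abs, hg, abs_pow]
    refine pow_le_pow_left₀ (abs_nonneg _) ((abs_sub _ _).trans ?_) 2
    gcongr
    rw [Nat.abs_cast]
    exact_mod_cast xorCount_le D v _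
  have hch := mul_meas_ge_le_integral_of_nonneg (μ := ν) (ae_of_all _ fun v => sq_nonneg _) hint
    ((η * (k : ℝ) ^ 2) ^ 2)
  have hsub : s ⊆ {v | (η * (k : ℝ) ^ 2) ^ 2 ≤ g v} := by
    intro v hv
    have h := hs v hv
    show (η * (k : ℝ) ^ 2) ^ 2 ≤ ((xorCount D v (k ^ 2) : ℝ) - ρ * (k ^ 2 : ℕ)) ^ 2
    rw [← sq_abs ((xorCount D v (k ^ 2) : ℝ) - ρ * (k ^ 2 : ℕ))]
    push_cast
    exact pow_le_pow_left₀ (by positivity) h 2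
  refine (measure_mono hsub).trans ?_
  rw [← ofReal_measureReal]
  refine ENNReal.ofReal_le_ofReal ?_
  have h2 := hch.trans (hvar (k ^ 2))
  have hpos : 0 < (η * (k : ℝ) ^ 2) ^ 2 := by positivity
  rw [← mul_le_mul_iff_right₀ hpos]
  refine h2.trans (le_of_eq ?_)
  push_cast
  field_simp

lemma exists_nat_div_eq {q : ℚ} (hq : 0 < q) : ∃ a b : ℕ, 0 < b ∧ (q : ℝ) = (a : ℝ) / b := by
  refine ⟨q.num.toNat, q.den, q.den_pos, ?_⟩
  have h : ((q.num.toNat : ℤ)) = q.num := Int.toNat_of_nonneg (Rat.num_nonneg.2 hq.le)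
  rw [Rat.cast_def, ← Int.cast_natCast (R := ℝ) q.num.toNat, h]

lemma primrecRel_lt_left (a b : ℕ) : PrimrecRel fun k c : ℕ => a * (k * k) < b * c :=
  Primrec.nat_lt.comp (Primrec.nat_mul.comp (Primrec.const a)
    (Primrec.nat_mul.comp Primrec.fst Primrec.fst))
    (Primrec.nat_mul.comp (Primrec.const b) Primrec.snd)

lemma primrecRel_lt_right (a b : ℕ) : PrimrecRel fun k c : ℕ => b * c < a * (k * k) :=
  Primrec.nat_lt.comp (Primrec.nat_mul.comp (Primrec.const b) Primrec.snd)
    (Primrec.nat_mul.comp (Primrec.const a) (Primrec.nat_mul.comp Primrec.fst Primrec.fst))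

/-- A rational threshold `q = a / b` strictly between `ρ` and the given bound turns a deviation into
a comparison of the integers `b * count` and `a * k ^ 2`, which is primitive recursive. So
`IsMLRandom.eventually_not` excludes it from some `k` on. -/
lemma IsMLRandom.tendsto_xorCount_sq {ν : Measure (ℕ → Bool)} [IsProbabilityMeasure ν]
    {u : ℕ → Bool} (hu : IsMLRandom ν u) (D : List ℕ) {ρ C : ℝ} (hρ : 0 ≤ ρ) (hC : 0 ≤ C)
    (hvar : ∀ N : ℕ, ∫ v, ((xorCount D v N : ℝ) - ρ * N) ^ 2 ∂ν ≤ C * N) :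
    Tendsto (fun k : ℕ => (xorCount D u (k ^ 2) : ℝ) / ((k ^ 2 : ℕ) : ℝ)) atTop (𝓝 ρ) := by
  rw [tendsto_order]
  constructor
  · intro x hx
    rcases lt_or_ge x 0 with h0 | h0
    · exact Eventually.of_forall fun k => lt_of_lt_of_le h0 (by positivity)
    obtain ⟨q, hq1, hq2⟩ := exists_rat_btwn hx
    have hq0 : 0 < q := by exact_mod_cast lt_of_le_of_lt h0 hq1
    obtain ⟨a, b, hb, hab⟩ := exists_nat_div_eq hq0
    have hb' : (0 : ℝ) < b := by exact_mod_cast hb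
    have hη : 0 < ρ - q := by linarith
    have hdev : ∀ k : ℕ, ∀ v ∈ {v : ℕ → Bool | b * xorCount D v (k ^ 2) < a * (k * k)},
        (ρ - q) * (k : ℝ) ^ 2 ≤ |(xorCount D v (k ^ 2) : ℝ) - ρ * (k : ℝ) ^ 2| := by
      intro k v hv
      have hv : b * xorCount D v (k ^ 2) < a * (k * k) := hv
      have hv : (b : ℝ) * xorCount D v (k ^ 2) < a * (k * k) := by exact_mod_cast hv
      have h1 : (xorCount D v (k ^ 2) : ℝ) ≤ q * k ^ 2 := by
        rw [hab, div_mul_eq_mul_div, le_div_iff₀ hb']; nlinarith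
      rw [abs_sub_comm]
      refine le_trans ?_ (le_abs_self _)
      linarith
    have hev := hu.eventually_not D (primrecRel_lt_right a b) (B := C / (ρ - q) ^ 2)
      (by positivity) fun k hk => measure_deviation_le D hη hvar k hk (hdev k)
    filter_upwards [hev, eventually_gt_atTop 0] with k hk hk0
    have hk0' : (0 : ℝ) < k := by exact_mod_cast hk0
    rw [not_lt] at hk
    have hk : (a : ℝ) * (k * k) ≤ b * xorCount D u (k ^ 2) := by exact_mod_cast hk
    refine lt_of_lt_of_le hq1 ?_
    push_cast
    rw [hab, div_le_div_iff₀ hb' (by positivity)]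
    nlinarith
  · intro x hx
    obtain ⟨q, hq1, hq2⟩ := exists_rat_btwn hx
    have hq0 : 0 < q := by exact_mod_cast lt_of_le_of_lt hρ hq1
    obtain ⟨a, b, hb, hab⟩ := exists_nat_div_eq hq0
    have hb' : (0 : ℝ) < b := by exact_mod_cast hb
    have hη : 0 < q - ρ := by linarith
    have hdev : ∀ k : ℕ, ∀ v ∈ {v : ℕ → Bool | a * (k * k) < b * xorCount D v (k ^ 2)},
        (q - ρ) * (k : ℝ) ^ 2 ≤ |(xorCount D v (k ^ 2) : ℝ) - ρ * (k : ℝ) ^ 2| := by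
      intro k v hv
      have hv : a * (k * k) < b * xorCount D v (k ^ 2) := hv
      have hv : (a : ℝ) * (k * k) < b * xorCount D v (k ^ 2) := by exact_mod_cast hv
      have h1 : (q : ℝ) * k ^ 2 ≤ xorCount D v (k ^ 2) := by
        rw [hab, div_mul_eq_mul_div, div_le_iff₀ hb']; nlinarith
      refine le_trans ?_ (le_abs_self _)
      linarith
    have hev := hu.eventually_not D (primrecRel_lt_left a b) (B := C / (q - ρ) ^ 2)
      (by positivity) fun k hk => measure_deviation_le D hη hvar k hk (hdev k)
    filter_upwards [hev, eventually_gt_atTop 0] with k hk hk0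
    have hk0' : (0 : ℝ) < k := by exact_mod_cast hk0
    rw [not_lt] at hk
    have hk : (b : ℝ) * xorCount D u (k ^ 2) ≤ a * (k * k) := by exact_mod_cast hk
    refine lt_of_le_of_lt ?_ hq2
    push_cast
    rw [hab, div_le_div_iff₀ (by positivity) hb']
    nlinarith

/-- Counts are monotone in `N` and `(k + 1) ^ 2 / k ^ 2` tends to `1`, so convergence along the
squares fills the gaps. -/
lemma IsMLRandom.tendsto_xorCount {ν : Measure (ℕ → Bool)} [IsProbabilityMeasure ν]
    {u : ℕ → Bool} (hu : IsMLRandom ν u) (D : List ℕ) {ρ C : ℝ} (hρ : 0 ≤ ρ) (hC : 0 ≤ C)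
    (hvar : ∀ N : ℕ, ∫ v, ((xorCount D v N : ℝ) - ρ * N) ^ 2 ∂ν ≤ C * N) :
    Tendsto (fun N : ℕ => (xorCount D u N : ℝ) / N) atTop (𝓝 ρ) := by
  refine tendsto_div_of_monotone_of_exists_subseq_tendsto_div _ ρ ?_ fun a ha => ?_
  · refine monotone_nat_of_le_succ fun N => ?_
    have : xorCount D u N ≤ xorCount D u (N + 1) := Nat.le_add_right _ _
    exact_mod_cast this
  · refine ⟨fun k => k ^ 2, ?_, tendsto_pow_atTop two_ne_zero,
      hu.tendsto_xorCount_sq D hρ hC hvar⟩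
    have h1 : Tendsto (fun k : ℕ => (1 + 1 / (k : ℝ)) ^ 2) atTop (𝓝 1) := by
      simpa using ((tendsto_one_div_atTop_nhds_zero_nat (𝕜 := ℝ)).const_add 1).pow 2
    filter_upwards [h1.eventually (eventually_le_nhds ha), eventually_gt_atTop 0] with k hk hk0
    have hk0' : (0 : ℝ) < k := by exact_mod_cast hk0
    push_cast
    calc ((k : ℝ) + 1) ^ 2 = (1 + 1 / (k : ℝ)) ^ 2 * k ^ 2 := by field_simp
      _ ≤ _ := mul_le_mul_of_nonneg_right hk (by positivity)

/-- A random sequence has no prefix of measure zero. -/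
lemma IsMLRandom.cylinder_pos {ν : Measure (ℕ → Bool)} {u : ℕ → Bool} (hu : IsMLRandom ν u)
    (n : ℕ) : ν (cylinder (prefixList u n)) ≠ 0 := by
  intro h
  -- A null cylinder, repeated at every level, is itself a test.
  refine hu (fun _ => ⋃ σ ∈ ({prefixList u n} : Set (List Bool)), cylinder σ)
    ⟨⟨fun _ => {prefixList u n}, ?_, fun _ => rfl⟩, fun k => ?_⟩ ?_
  · refine ComputablePred.to_re (PrimrecPred.computablePred ?_)
    exact Primrec.eq.comp Primrec.snd (Primrec.const (prefixList u n))
  · simp [h]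
  · simp [mem_cylinder_prefixList]

/-! ### Block averages of random microstates -/

lemma prod_Ico_int_succ (f : ℤ → ℝ) (i : ℤ) (s : ℕ) :
    ∏ a ∈ Finset.Ico i (i + (s + 1 : ℕ)), f a = (∏ a ∈ Finset.Ico i (i + s), f a) * f (i + s) := by
  have : Finset.Ico i (i + (s + 1 : ℕ)) = insert (i + s : ℤ) (Finset.Ico i (i + s)) := by
    ext a; simp only [Finset.mem_Ico, Finset.mem_insert]; push_cast; omega
  rw [this, Finset.prod_insert (by simp), mul_comm]

/-- The sign of `x i` times the signs of `y i, …, y (i + s - 1)`. -/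
noncomputable def block (s : ℕ) (z : Microstate) (i : ℤ) : ℝ :=
  sgn (z.1 i) * ∏ a ∈ Finset.Ico i (i + s), sgn (z.2 a)

lemma site_two_mul (j : ℕ) : site (2 * j) = j := by
  simp [site]

lemma site_two_mul_add_one (j : ℕ) : site (2 * j + 1) = -((j : ℤ) + 1) := by
  have h : ¬ Even (2 * j + 1) := by simp
  rw [site, if_neg h, show (2 * j + 1 + 1) / 2 = j + 1 by omega]
  push_cast; ring

lemma code_even (z : Microstate) (k : ℕ) : code z (2 * k) = z.1 (site k) := by
  simp [code, kappa, iota]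

lemma code_odd (z : Microstate) (k : ℕ) : code z (2 * k + 1) = z.2 (site k) := by
  have h : ¬ Even (2 * k + 1) := by simp
  rw [code, kappa, if_neg h, show (2 * k + 1) / 2 = k by omega]; rfl

lemma measurable_code : Measurable code := by
  refine measurable_pi_lambda _ fun n => ?_
  obtain ⟨k, rfl | rfl⟩ : ∃ k, n = 2 * k ∨ n = 2 * k + 1 := ⟨n / 2, by omega⟩
  · simp_rw [code_even]; exact (measurable_pi_apply _).comp measurable_fst
  · simp_rw [code_odd]; exact (measurable_pi_apply _).comp measurable_snd

lemma sgn_xorAt (D : List ℕ) (u : ℕ → Bool) (j : ℕ) :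
    sgn (xorAt D u j) = (D.map fun d => sgn (u (4 * j + d))).prod := by
  induction D with
  | nil => simp [xorAt, sgn]
  | cons d D ih =>
    rw [List.map_cons, List.prod_cons, ← ih, ← sgn_xor]; rfl

/-- The positions, relative to `4 j`, of the bits of `block s z j` in the code of `z`. -/
def posOffsets (s : ℕ) : List ℕ := 0 :: (List.range s).map fun l => 4 * l + 1

/-- The positions, relative to `4 j`, of the bits of `block s z (-(j + c + 1))` in the code of
`z`. -/
def negOffsets (c s : ℕ) : List ℕ :=
  (4 * c + 2) :: (List.range s).map fun l => 4 * (c - l) + 3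

/-- For `j ≥ 0` the code stores the spin at site `j` at position `4 j` and the scatterer at `4 j +
1`; moving one site to the right adds `4`. -/
lemma sgn_xorAt_posOffsets (s : ℕ) (z : Microstate) (j : ℕ) :
    sgn (xorAt (posOffsets s) (code z) j) = block s z j := by
  have h0 : code z (4 * j + 0) = z.1 j := by
    rw [show 4 * j + 0 = 2 * (2 * j) by ring, code_even, site_two_mul]
  have h1 : ∀ l : ℕ, code z (4 * j + (4 * l + 1)) = z.2 (j + l) := by
    intro l
    rw [show 4 * j + (4 * l + 1) = 2 * (2 * (j + l)) + 1 by ring, code_odd, site_two_mul]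
    push_cast; rfl
  rw [sgn_xorAt, posOffsets, List.map_cons, List.prod_cons, List.map_map, block, h0]
  congr 1
  induction s with
  | zero => simp
  | succ s ih =>
    rw [List.range_succ, List.map_append, List.prod_append, ih, prod_Ico_int_succ]
    simp [h1]

/-- The site `-(j + 1)` occupies the positions `4 j + 2` and `4 j + 3`. Blocks extend to the right,
hence towards the origin on this side; `s ≤ c` keeps the whole block at negative sites, where one
step to the right subtracts `4`. -/
lemma sgn_xorAt_negOffsets {c s : ℕ} (hs : s ≤ c) (z : Microstate) (j : ℕ) :
    sgn (xorAt (negOffsets c s) (code z) j) = block s z (-((j : ℤ) + c + 1)) := by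
  have h0 : code z (4 * j + (4 * c + 2)) = z.1 (-((j : ℤ) + c + 1)) := by
    rw [show 4 * j + (4 * c + 2) = 2 * (2 * (j + c) + 1) by ring, code_even, site_two_mul_add_one]
    push_cast; rfl
  have h1 : ∀ l ≤ c, code z (4 * j + (4 * (c - l) + 3)) = z.2 (-((j : ℤ) + c + 1) + l) := by
    intro l hl
    rw [show 4 * j + (4 * (c - l) + 3) = 2 * (2 * (j + (c - l)) + 1) + 1 by ring, code_odd,
      site_two_mul_add_one]
    have : -(((j + (c - l) : ℕ) : ℤ) + 1) = -((j : ℤ) + c + 1) + l := by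
      rw [Nat.cast_add, Nat.cast_sub hl]; ring
    rw [this]
  rw [sgn_xorAt, negOffsets, List.map_cons, List.prod_cons, List.map_map, block, h0]
  congr 1
  induction s with
  | zero => simp
  | succ s ih =>
    rw [List.range_succ, List.map_append, List.prod_append, ih (by omega), prod_Ico_int_succ]
    simp [h1 s (by omega)]

lemma abs_prod_sgn (A : Finset ℤ) (x : Config) : |∏ a ∈ A, sgn (x a)| = 1 := by
  rw [Finset.abs_prod]; simp [abs_sgn]

lemma abs_block (s : ℕ) (z : Microstate) (i : ℤ) : |block s z i| = 1 := by
  rw [block, abs_mul, abs_sgn, abs_prod_sgn, one_mul]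

lemma measurable_prod_sgn (A : Finset ℤ) : Measurable fun x : Config => ∏ a ∈ A, sgn (x a) :=
  Finset.measurable_prod _ fun a _ => (Measurable.of_discrete (f := sgn)).comp (measurable_pi_apply a)

lemma measurable_block (s : ℕ) (i : ℤ) : Measurable fun z => block s z i :=
  ((Measurable.of_discrete (f := sgn)).comp ((measurable_pi_apply i).comp measurable_fst)).mul
    ((measurable_prod_sgn _).comp measurable_snd)

section

variable {m : ℝ × ℝ}

lemma prob_mem (h0 : m.1 ∈ Set.Icc (-1 : ℝ) 1) : (1 + m.1) / 2 ∈ Set.Icc (0 : ℝ) 1 := by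
  obtain ⟨a, b⟩ := h0; constructor <;> linarith

/-- The expectation of `block s z i` under the Gibbs measure. -/
def blockMean (m : ℝ × ℝ) (s : ℕ) : ℝ := -m.1 * (1 - 2 * m.2) ^ s

lemma integral_prod_sgn_mul (h0 : m.1 ∈ Set.Icc (-1 : ℝ) 1) (h1 : m.2 ∈ Set.Icc (0 : ℝ) 1)
    (A B : Finset ℤ) :
    ∫ z, (∏ a ∈ A, sgn (z.1 a)) * ∏ a ∈ B, sgn (z.2 a) ∂gibbs m =
      (-m.1) ^ A.card * (1 - 2 * m.2) ^ B.card := by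
  rw [gibbs, integral_prod_mul (fun x : Config => ∏ a ∈ A, sgn (x a))
    (fun y : Config => ∏ a ∈ B, sgn (y a)), integral_prod_sgn (prob_mem h0), integral_prod_sgn h1]
  congr 2
  ring

lemma integral_block (h0 : m.1 ∈ Set.Icc (-1 : ℝ) 1) (h1 : m.2 ∈ Set.Icc (0 : ℝ) 1)
    (s : ℕ) (i : ℤ) : ∫ z, block s z i ∂gibbs m = blockMean m s := by
  have := integral_prod_sgn_mul h0 h1 {i} (Finset.Ico i (i + s))
  simpa [block, blockMean] using this

/-- At distance greater than `s` the two blocks share no spin and no scatterer. The strict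
inequality separates the spins also for `s = 0`. -/
lemma integral_block_mul_block (h0 : m.1 ∈ Set.Icc (-1 : ℝ) 1) (h1 : m.2 ∈ Set.Icc (0 : ℝ) 1)
    (s : ℕ) {i k : ℤ} (hik : (s : ℤ) < |i - k|) :
    ∫ z, block s z i * block s z k ∂gibbs m = blockMean m s ^ 2 := by
  have hne : i ≠ k := by
    rintro rfl
    simp at hik
    omega
  have hd : Disjoint (Finset.Ico i (i + s)) (Finset.Ico k (k + s)) := by
    rw [Finset.disjoint_left]
    intro a ha hb
    rw [Finset.mem_Ico] at ha hb
    rcases abs_cases (i - k) with ⟨h, _⟩ | ⟨h, _⟩ <;> omega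
  have := integral_prod_sgn_mul h0 h1 {i, k} (Finset.Ico i (i + s) ∪ Finset.Ico k (k + s))
  rw [Finset.card_union_of_disjoint hd, Finset.card_pair hne] at this
  simp only [Finset.prod_union hd, Finset.prod_pair hne, Int.card_Ico] at this
  calc _ = ∫ z : Microstate, sgn (z.1 i) * sgn (z.1 k) * ((∏ a ∈ Finset.Ico i (i + s), sgn (z.2 a)) *
          ∏ a ∈ Finset.Ico k (k + s), sgn (z.2 a)) ∂gibbs m := by
        refine integral_congr_ae (ae_of_all _ fun z => ?_)
        simp only [block]; ring
    _ = _ := by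
        rw [this, blockMean]
        simp
        ring

lemma abs_blockMean_le (h0 : m.1 ∈ Set.Icc (-1 : ℝ) 1) (h1 : m.2 ∈ Set.Icc (0 : ℝ) 1) (s : ℕ) :
    |blockMean m s| ≤ 1 := by
  rw [blockMean, abs_mul, abs_neg, abs_pow]
  refine mul_le_one₀ (abs_le.2 h0) (by positivity) (pow_le_one₀ (abs_nonneg _) (abs_le.2 ?_))
  obtain ⟨a, b⟩ := h1
  constructor <;> linarith

/-- Expand the square: only pairs with `|j - k| ≤ s` can be correlated, at most `2 * s + 1` in each
row, and each covariance is bounded. -/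
lemma integral_sq_sum_block_le (h0 : m.1 ∈ Set.Icc (-1 : ℝ) 1) (h1 : m.2 ∈ Set.Icc (0 : ℝ) 1)
    (s : ℕ) {e : ℕ → ℤ} (he : ∀ j k, |e j - e k| = |(j : ℤ) - k|) (N : ℕ) :
    ∫ z, (∑ j ∈ Finset.range N, (block s z (e j) - blockMean m s)) ^ 2 ∂gibbs m ≤
      4 * (2 * s + 1) * N := by
  set θ := blockMean m s with hθ
  have hθ1 : |θ| ≤ 1 := abs_blockMean_le h0 h1 s
  have hib : ∀ i, Integrable (fun z => block s z i) (gibbs m) := fun i =>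
    Integrable.of_bound (measurable_block s i).aestronglyMeasurable 1
      (ae_of_all _ fun z => by rw [Real.norm_eq_abs, abs_block])
  have hib2 : ∀ i k, Integrable (fun z => block s z i * block s z k) (gibbs m) := fun i k =>
    Integrable.of_bound ((measurable_block s i).mul (measurable_block s k)).aestronglyMeasurable 1
      (ae_of_all _ fun z => by rw [Real.norm_eq_abs, abs_mul, abs_block, abs_block, one_mul])
  have hexp : ∀ i k, (fun z => (block s z i - θ) * (block s z k - θ)) =
      fun z => (block s z i * block s z k - θ * block s z i) - (θ * block s z k - θ ^ 2) := by
    intro i k; funext z; ring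
  have hint : ∀ i k, Integrable (fun z => (block s z i - θ) * (block s z k - θ)) (gibbs m) := by
    intro i k
    rw [hexp]
    exact ((hib2 i k).sub ((hib i).const_mul θ)).sub (((hib k).const_mul θ).sub
      (integrable_const _))
  have hval : ∀ i k, ∫ z, (block s z i - θ) * (block s z k - θ) ∂gibbs m =
      ∫ z, block s z i * block s z k ∂gibbs m - θ ^ 2 := by
    intro i k
    have i1 : Integrable (fun z => θ * block s z i) (gibbs m) := (hib i).const_mul θ
    have i2 : Integrable (fun z => θ * block s z k) (gibbs m) := (hib k).const_mul θ
    have i3 : Integrable (fun _ : Microstate => θ ^ 2) (gibbs m) := integrable_const _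
    have i4 : Integrable (fun z => block s z i * block s z k - θ * block s z i) (gibbs m) :=
      (hib2 i k).sub i1
    have i5 : Integrable (fun z => θ * block s z k - θ ^ 2) (gibbs m) := i2.sub i3
    rw [hexp, integral_sub i4 i5, integral_sub (hib2 i k) i1, integral_sub i2 i3,
      integral_const_mul, integral_const_mul, integral_block h0 h1, integral_block h0 h1,
      integral_const]
    simp
    ring
  have hcov : ∀ j k : ℕ, ∫ z, (block s z (e j) - θ) * (block s z (e k) - θ) ∂gibbs m ≤
      if k ∈ Finset.Icc (j - s) (j + s) then 4 else 0 := by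
    intro j k
    split_ifs with hjk
    · rw [hval]
      have : ∫ z, block s z (e j) * block s z (e k) ∂gibbs m ≤ 1 := by
        refine (integral_mono (hib2 _ _) (integrable_const 1) fun z => ?_).trans (by simp)
        refine (le_abs_self _).trans ?_
        simp [abs_mul, abs_block]
      nlinarith [sq_nonneg θ]
    · rw [hval, integral_block_mul_block h0 h1 s, ← hθ, sub_self]
      rw [he]
      rw [Finset.mem_Icc] at hjk
      rcases abs_cases ((j : ℤ) - k) with ⟨h, _⟩ | ⟨h, _⟩ <;> omega
  simp_rw [sq, Finset.sum_mul_sum]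
  rw [integral_finsetSum _ fun j _ => integrable_finsetSum _ fun k _ => hint _ _]
  have hrow : ∀ j ∈ Finset.range N,
      ∫ z, ∑ k ∈ Finset.range N, (block s z (e j) - θ) * (block s z (e k) - θ) ∂gibbs m ≤
        4 * (2 * s + 1) := by
    intro j _
    rw [integral_finsetSum _ fun k _ => hint _ _]
    refine (Finset.sum_le_sum fun k _ => hcov j k).trans ?_
    rw [← Finset.sum_filter, Finset.sum_const, nsmul_eq_mul, mul_comm]
    refine mul_le_mul_of_nonneg_left ?_ (by norm_num)
    have : ((Finset.range N).filter (· ∈ Finset.Icc (j - s) (j + s))).card ≤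
        (Finset.Icc (j - s) (j + s)).card :=
      Finset.card_le_card fun k hk => (Finset.mem_filter.1 hk).2
    rw [Nat.card_Icc] at this
    have h2 : ((Finset.range N).filter (· ∈ Finset.Icc (j - s) (j + s))).card ≤ 2 * s + 1 := by
      omega
    exact_mod_cast h2
  refine (Finset.sum_le_sum hrow).trans ?_
  rw [Finset.sum_const, Finset.card_range, nsmul_eq_mul, mul_comm]

lemma isMLRandom_tendsto_block (h0 : m.1 ∈ Set.Icc (-1 : ℝ) 1) (h1 : m.2 ∈ Set.Icc (0 : ℝ) 1)
    {z : Microstate} (hz : IsMLRandomState (gibbs m) z) (s : ℕ) {e : ℕ → ℤ}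
    (he : ∀ j k, |e j - e k| = |(j : ℤ) - k|) {D : List ℕ}
    (hD : ∀ w j, sgn (xorAt D (code w) j) = block s w (e j)) :
    Tendsto (fun N : ℕ => (∑ j ∈ Finset.range N, block s z (e j)) / N) atTop
      (𝓝 (blockMean m s)) := by
  have : IsProbabilityMeasure ((gibbs m).map code) :=
    Measure.isProbabilityMeasure_map measurable_code.aemeasurable
  have hnat : ∀ b : Bool, ((b.toNat : ℕ) : ℝ) = (1 - sgn b) / 2 := by
    intro b; cases b <;> norm_num [sgn]
  have hcount : ∀ w N, (xorCount D (code w) N : ℝ) =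
      ∑ j ∈ Finset.range N, (1 - block s w (e j)) / 2 := by
    intro w N
    rw [xorCount_eq_sum]
    push_cast
    exact Finset.sum_congr rfl fun j _ => by rw [hnat, hD]
  set θ := blockMean m s with hθ
  have hθ1 := abs_le.1 (abs_blockMean_le h0 h1 s)
  -- A bit is `(1 - sgn b) / 2`, which turns the mean `θ` of the blocks into the density `(1 - θ) /
  -- 2` of ones and divides the second moment by `4`.
  have key := hz.tendsto_xorCount D (ρ := (1 - θ) / 2) (C := 2 * s + 1) (by linarith [hθ1.2])
    (by positivity) ?_
  · have h2 := (key.const_mul 2).const_sub 1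
    rw [show 1 - 2 * ((1 - θ) / 2) = θ by ring] at h2
    refine h2.congr' ?_
    filter_upwards [eventually_gt_atTop 0] with N hN
    have : (N : ℝ) ≠ 0 := by positivity
    rw [hcount, ← Finset.sum_div, Finset.sum_sub_distrib]
    simp
    field_simp
    ring
  · intro N
    rw [integral_map measurable_code.aemeasurable]
    · have heq : ∀ w, ((xorCount D (code w) N : ℝ) - (1 - θ) / 2 * N) ^ 2 =
          (1 / 4) * (∑ j ∈ Finset.range N, (block s w (e j) - θ)) ^ 2 := by
        intro w
        rw [hcount, ← Finset.sum_div, Finset.sum_sub_distrib, Finset.sum_sub_distrib]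
        simp
        ring
      simp_rw [heq]
      rw [integral_const_mul]
      have := integral_sq_sum_block_le h0 h1 s he N
      linarith
    · exact ((((Measurable.of_discrete (f := fun n : ℕ => (n : ℝ))).comp
        (measurable_xorCount D N)).sub_const _).pow_const 2).aestronglyMeasurable

lemma tendsto_block_pos (h0 : m.1 ∈ Set.Icc (-1 : ℝ) 1) (h1 : m.2 ∈ Set.Icc (0 : ℝ) 1)
    {z : Microstate} (hz : IsMLRandomState (gibbs m) z) (s : ℕ) :
    Tendsto (fun N : ℕ => (∑ j ∈ Finset.range N, block s z j) / N) atTop (𝓝 (blockMean m s)) :=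
  isMLRandom_tendsto_block h0 h1 hz s (e := fun j => (j : ℤ)) (fun _ _ => rfl)
    (sgn_xorAt_posOffsets s)

lemma tendsto_block_neg (h0 : m.1 ∈ Set.Icc (-1 : ℝ) 1) (h1 : m.2 ∈ Set.Icc (0 : ℝ) 1)
    {z : Microstate} (hz : IsMLRandomState (gibbs m) z) {s c : ℕ} (hs : s ≤ c) :
    Tendsto (fun N : ℕ => (∑ j ∈ Finset.range N, block s z (-((j : ℤ) + c + 1))) / N) atTop
      (𝓝 (blockMean m s)) :=
  isMLRandom_tendsto_block h0 h1 hz s (e := fun j => -((j : ℤ) + c + 1))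
    (fun j k => by rw [← abs_neg]; congr 1; ring) (sgn_xorAt_negOffsets hs)

end

/-! ### Cesàro averages -/

lemma tendsto_average_shift {g : ℕ → ℝ} {θ : ℝ} (t : ℕ)
    (h : Tendsto (fun N : ℕ => (∑ j ∈ Finset.range N, g (j + t)) / N) atTop (𝓝 θ)) :
    Tendsto (fun N : ℕ => (∑ j ∈ Finset.range N, g j) / N) atTop (𝓝 θ) := by
  rw [← tendsto_add_atTop_iff_nat t]
  have h1 : Tendsto (fun N : ℕ => (∑ j ∈ Finset.range t, g j) / ((N + t : ℕ) : ℝ)) atTop (𝓝 0) :=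
    (tendsto_const_div_atTop_nhds_zero_nat _).comp (tendsto_add_atTop_nat t)
  have h2 : Tendsto (fun N : ℕ => 1 - (t : ℝ) / ((N + t : ℕ) : ℝ)) atTop (𝓝 (1 - 0)) :=
    ((tendsto_const_div_atTop_nhds_zero_nat _).comp (tendsto_add_atTop_nat t)).const_sub 1
  have h3 := h1.add (h.mul h2)
  rw [sub_zero, mul_one, zero_add] at h3
  refine h3.congr' ?_
  filter_upwards [eventually_gt_atTop 0] with N hN
  have e1 : (N : ℝ) ≠ 0 := by positivity
  have e2 : ((N + t : ℕ) : ℝ) ≠ 0 := by positivity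
  rw [add_comm N t, Finset.sum_range_add]
  have e3 : ∑ x ∈ Finset.range N, g (t + x) = ∑ x ∈ Finset.range N, g (x + t) :=
    Finset.sum_congr rfl fun x _ => by rw [add_comm]
  rw [e3]
  push_cast at e2 ⊢
  rw [add_comm (t : ℝ)]
  field_simp
  ring

lemma sum_site (f : ℤ → ℝ) (n : ℕ) :
    ∑ k ∈ Finset.range n, f (site k) =
      ∑ j ∈ Finset.range ((n + 1) / 2), f j + ∑ j ∈ Finset.range (n / 2), f (-((j : ℤ) + 1)) := by
  induction n with
  | zero => simp
  | succ n ih =>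
    rw [Finset.sum_range_succ, ih]
    obtain ⟨k, rfl | rfl⟩ : ∃ k, n = 2 * k ∨ n = 2 * k + 1 := ⟨n / 2, by omega⟩
    · rw [site_two_mul, show (2 * k + 1 + 1) / 2 = k + 1 by omega,
        show (2 * k + 1) / 2 = k by omega, show 2 * k / 2 = k by omega, Finset.sum_range_succ]
      ring
    · rw [site_two_mul_add_one, show (2 * k + 1 + 1 + 1) / 2 = k + 1 by omega,
        show (2 * k + 1 + 1) / 2 = k + 1 by omega, show (2 * k + 1) / 2 = k by omega,
        Finset.sum_range_succ (fun j : ℕ => f (-((j : ℤ) + 1)))]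
      ring

/-- The first `n` sites consist of `⌈n / 2⌉` nonnegative and `⌊n / 2⌋` negative ones, so each
half-line enters the average with asymptotic weight `1 / 2`. -/
lemma tendsto_average_site {f : ℤ → ℝ} {θ : ℝ}
    (hpos : Tendsto (fun N : ℕ => (∑ j ∈ Finset.range N, f j) / N) atTop (𝓝 θ))
    (hneg : Tendsto (fun N : ℕ => (∑ j ∈ Finset.range N, f (-((j : ℤ) + 1))) / N) atTop (𝓝 θ)) :
    Tendsto (fun n : ℕ => (∑ k ∈ Finset.range n, f (site k)) / n) atTop (𝓝 θ) := by
  have a1 : Tendsto (fun n : ℕ => (n + 1) / 2) atTop atTop :=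
    tendsto_atTop_atTop.2 fun b => ⟨2 * b, fun a ha => by omega⟩
  have a2 : Tendsto (fun n : ℕ => n / 2) atTop atTop :=
    tendsto_atTop_atTop.2 fun b => ⟨2 * b, fun a ha => by omega⟩
  have hhalf : Tendsto (fun n : ℕ => (((n / 2 : ℕ) : ℝ)) / n) atTop (𝓝 (1 / 2)) := by
    have lo : Tendsto (fun n : ℕ => (1 / 2 : ℝ) - 1 / (n : ℝ)) atTop (𝓝 (1 / 2)) := by
      have := (tendsto_one_div_atTop_nhds_zero_nat (𝕜 := ℝ)).const_sub (1 / 2)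
      rwa [sub_zero] at this
    refine tendsto_of_tendsto_of_tendsto_of_le_of_le' lo tendsto_const_nhds ?_ ?_
    · filter_upwards [eventually_gt_atTop 0] with n hn
      have hn' : (0 : ℝ) < n := by exact_mod_cast hn
      have : (n : ℝ) ≤ 2 * ((n / 2 : ℕ) : ℝ) + 1 := by exact_mod_cast (by omega)
      rw [le_div_iff₀ hn', sub_mul, div_mul_cancel₀ _ hn'.ne']
      linarith
    · filter_upwards [eventually_gt_atTop 0] with n hn
      have hn' : (0 : ℝ) < n := by exact_mod_cast hn
      have : 2 * ((n / 2 : ℕ) : ℝ) ≤ n := by exact_mod_cast (by omega)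
      rw [div_le_iff₀ hn']
      linarith
  have hhalf' : Tendsto (fun n : ℕ => ((((n + 1) / 2 : ℕ) : ℝ)) / n) atTop (𝓝 (1 / 2)) := by
    have := hhalf.const_sub 1
    rw [show (1 : ℝ) - 1 / 2 = 1 / 2 by norm_num] at this
    refine this.congr' ?_
    filter_upwards [eventually_gt_atTop 0] with n hn
    have hn' : (n : ℝ) ≠ 0 := by positivity
    have : (n : ℝ) = ((n / 2 : ℕ) : ℝ) + (((n + 1) / 2 : ℕ) : ℝ) := by exact_mod_cast (by omega)
    rw [one_sub_div hn']
    congr 1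
    linarith
  have := ((hpos.comp a1).mul hhalf').add ((hneg.comp a2).mul hhalf)
  rw [show θ * (1 / 2) + θ * (1 / 2) = θ by ring] at this
  refine this.congr' ?_
  filter_upwards [eventually_gt_atTop 1] with n hn
  have e1 : (((n + 1) / 2 : ℕ) : ℝ) ≠ 0 := by
    have : 0 < (n + 1) / 2 := by omega
    positivity
  have e2 : ((n / 2 : ℕ) : ℝ) ≠ 0 := by
    have : 0 < n / 2 := by omega
    positivity
  have e3 : (n : ℝ) ≠ 0 := by positivity
  rw [sum_site]
  simp only [Function.comp]
  field_simp

/-- Dropping the first `t` terms on each half-line removes the blocks that the shift may bring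
across the origin. On the left the remaining ones start at `-(j + 2 * t + 1)`, which is the case `c
= 2 * t` and needs `s ≤ 2 * t`. -/
lemma tendsto_average_block_site {m : ℝ × ℝ} (h0 : m.1 ∈ Set.Icc (-1 : ℝ) 1)
    (h1 : m.2 ∈ Set.Icc (0 : ℝ) 1) {z : Microstate} (hz : IsMLRandomState (gibbs m) z) {s t : ℕ}
    (hs : s ≤ 2 * t) :
    Tendsto (fun n : ℕ => (∑ k ∈ Finset.range n, block s z (site k - t)) / n) atTop
      (𝓝 (blockMean m s)) := by
  refine tendsto_average_site (f := fun i => block s z (i - t)) ?_ ?_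
  · refine tendsto_average_shift (g := fun j => block s z ((j : ℤ) - t)) t ?_
    refine (tendsto_block_pos h0 h1 hz s).congr fun N => ?_
    congr 1
    refine Finset.sum_congr rfl fun j _ => ?_
    push_cast
    rw [add_sub_cancel_right]
  · refine tendsto_average_shift (g := fun j => block s z (-((j : ℤ) + 1) - t)) t ?_
    refine (tendsto_block_neg h0 h1 hz hs).congr fun N => ?_
    congr 1
    refine Finset.sum_congr rfl fun j _ => ?_
    congr 1
    push_cast
    ring

/-! ### The dynamics and the events of the information loss -/

/-- The parity of `y a + … + y (a + s - 1)`. -/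
def parity (y : Config) (a : ℤ) : ℕ → Bool
  | 0 => false
  | s + 1 => xor (parity y a s) (y (a + s))

lemma sgn_injective : Function.Injective sgn := by
  intro a b h
  cases a <;> cases b <;> simp [sgn] at h ⊢ <;> norm_num at h

lemma sgn_parity (y : Config) (a : ℤ) (s : ℕ) :
    sgn (parity y a s) = ∏ i ∈ Finset.Ico a (a + s), sgn (y i) := by
  induction s with
  | zero => simp [parity, sgn]
  | succ s ih => rw [prod_Ico_int_succ, ← ih, ← sgn_xor]; rfl

lemma parity_add (y : Config) (a : ℤ) (s r : ℕ) :
    parity y a (s + r) = xor (parity y a s) (parity y (a + s) r) := by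
  induction r with
  | zero => simp [parity]
  | succ r ih =>
    rw [← add_assoc, parity, ih, parity, Bool.xor_assoc]
    push_cast
    rw [add_assoc a]

lemma parity_congr {y y' : Config} {a : ℤ} {s : ℕ}
    (h : ∀ i, a ≤ i → i < a + s → y i = y' i) : parity y a s = parity y' a s := by
  refine sgn_injective ?_
  rw [sgn_parity, sgn_parity]
  refine Finset.prod_congr rfl fun i hi => ?_
  rw [Finset.mem_Ico] at hi
  rw [h i hi.1 hi.2]

lemma parity_reflect (y : Config) (i : ℤ) (t : ℕ) :
    parity (fun j => y (-j - 1)) i t = parity y (-i - t) t := by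
  refine sgn_injective ?_
  rw [sgn_parity, sgn_parity]
  refine Finset.prod_bij (fun a _ => -a - 1) ?_ ?_ ?_ ?_
  · intro a ha; rw [Finset.mem_Ico] at ha ⊢; omega
  · intro a _ b _ h; omega
  · intro b hb
    rw [Finset.mem_Ico] at hb
    exact ⟨-b - 1, by rw [Finset.mem_Ico]; omega, by ring⟩
  · intro a _; rfl

lemma phi_iterate (t : ℕ) (z : Microstate) :
    phi^[t] z = (fun i => xor (z.1 (i - t)) (parity z.2 (i - t) t), z.2) := by
  induction t with
  | zero => simp [parity]
  | succ t ih =>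
    rw [Function.iterate_succ_apply', ih, phi]
    refine Prod.ext ?_ rfl
    funext i
    have e1 : i - 1 - (t : ℤ) = i - ((t + 1 : ℕ) : ℤ) := by push_cast; ring
    have e2 : i - ((t + 1 : ℕ) : ℤ) + t = i - 1 := by push_cast; ring
    simp only [parity, e1, e2, Bool.xor_assoc]

lemma block_eq_sgn (s : ℕ) (z : Microstate) (i : ℤ) :
    block s z i = sgn (xor (z.1 i) (parity z.2 i s)) := by
  rw [sgn_xor, sgn_parity, block]

lemma reversal_reversal (z : Microstate) : reversal (reversal z) = z := by
  refine Prod.ext ?_ ?_ <;> funext i <;> simp [reversal]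

lemma reversal_image (s : Set Microstate) : reversal '' s = reversal ⁻¹' s :=
  congrFun (Set.image_eq_preimage_of_inverse reversal_reversal reversal_reversal) s

lemma site_injective : Function.Injective site := by
  intro a b h
  obtain ⟨k, rfl | rfl⟩ : ∃ k, a = 2 * k ∨ a = 2 * k + 1 := ⟨a / 2, by omega⟩ <;>
  obtain ⟨l, rfl | rfl⟩ : ∃ l, b = 2 * l ∨ b = 2 * l + 1 := ⟨b / 2, by omega⟩ <;>
  simp only [site_two_mul, site_two_mul_add_one] at h <;> omega

lemma exists_site_eq (i : ℤ) : ∃ k, site k = i := by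
  rcases le_or_gt 0 i with h | h
  · exact ⟨2 * i.toNat, by rw [site_two_mul]; omega⟩
  · exact ⟨2 * (-i - 1).toNat + 1, by rw [site_two_mul_add_one]; omega⟩

/-- The first `n` sites. -/
def sites (n : ℕ) : Finset ℤ := (Finset.range n).image site

lemma mem_sites {n : ℕ} {i : ℤ} : i ∈ sites n ↔ -((n / 2 : ℕ) : ℤ) ≤ i ∧ i < ((n + 1) / 2 : ℕ) := by
  rw [sites, Finset.mem_image]
  constructor
  · rintro ⟨a, ha, rfl⟩
    rw [Finset.mem_range] at ha
    obtain ⟨k, rfl | rfl⟩ : ∃ k, a = 2 * k ∨ a = 2 * k + 1 := ⟨a / 2, by omega⟩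
    · rw [site_two_mul]; omega
    · rw [site_two_mul_add_one]; omega
  · rintro ⟨h1, h2⟩
    rcases le_or_gt 0 i with h | h
    · exact ⟨2 * i.toNat, by rw [Finset.mem_range]; omega, by rw [site_two_mul]; omega⟩
    · exact ⟨2 * (-i - 1).toNat + 1, by rw [Finset.mem_range]; omega,
        by rw [site_two_mul_add_one]; omega⟩

lemma sum_sites (f : ℤ → ℝ) (n : ℕ) :
    ∑ i ∈ sites n, f i = ∑ k ∈ Finset.range n, f (site k) :=
  Finset.sum_image fun _ _ _ _ h => site_injective h

lemma window_eq (z : Microstate) (n : ℕ) :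
    window z n = {w | ∀ i ∈ sites n, w.1 i = z.1 i ∧ w.2 i = z.2 i} := by
  ext w
  simp [window, sites, iota]

/-- The microstates with scatterers `Y` on `W` and spins `X` on `W`, up to the change of the
parity of the `t` scatterers from `i + c` on with respect to `Y`. -/
def event (W : Finset ℤ) (c : ℤ) (t : ℕ) (X Y : Config) : Set Microstate :=
  {w | ∀ i ∈ W, w.1 i = xor (X i) (xor (parity Y (i + c) t) (parity w.2 (i + c) t)) ∧ w.2 i = Y i}

lemma measurable_parity (a : ℤ) (s : ℕ) : Measurable fun y : Config => parity y a s := by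
  induction s with
  | zero => exact measurable_const
  | succ s ih =>
    have h : Measurable fun p : Bool × Bool => xor p.1 p.2 := Measurable.of_discrete
    exact h.comp (ih.prodMk (measurable_pi_apply (a + s)))

lemma measurableSet_event (W : Finset ℤ) (c : ℤ) (t : ℕ) (X Y : Config) :
    MeasurableSet (event W c t X Y) := by
  have : event W c t X Y = ⋂ i ∈ W, {w : Microstate |
      w.1 i = xor (X i) (xor (parity Y (i + c) t) (parity w.2 (i + c) t)) ∧ w.2 i = Y i} := by
    ext w; simp [event]
  rw [this]
  refine Finset.measurableSet_biInter _ fun i _ => ?_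
  refine MeasurableSet.inter ?_ ?_
  · refine measurableSet_eq_fun ((measurable_pi_apply i).comp measurable_fst) ?_
    exact (Measurable.of_discrete (f := fun b => xor (X i) (xor (parity Y (i + c) t) b))).comp
      ((measurable_parity _ _).comp measurable_snd)
  · exact measurableSet_eq_fun ((measurable_pi_apply i).comp measurable_snd) measurable_const

lemma measurable_phi_iterate (t : ℕ) : Measurable (phi^[t]) := by
  have : phi^[t] = fun z => (fun i => xor (z.1 (i - t)) (parity z.2 (i - t) t), z.2) :=
    funext (phi_iterate t)
  rw [this]
  refine Measurable.prodMk (measurable_pi_lambda _ fun i => ?_) measurable_snd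
  have h : Measurable fun p : Bool × Bool => xor p.1 p.2 := Measurable.of_discrete
  have h1 : Measurable fun z : Microstate => z.1 (i - t) :=
    (measurable_pi_apply _).comp measurable_fst
  have h2 : Measurable fun z : Microstate => parity z.2 (i - t) t :=
    (measurable_parity _ _).comp measurable_snd
  exact h.comp (h1.prodMk h2)

lemma measurable_reversal : Measurable reversal :=
  (measurable_pi_lambda _ fun _ => (measurable_pi_apply _).comp measurable_fst).prodMk
    (measurable_pi_lambda _ fun _ => (measurable_pi_apply _).comp measurable_snd)

lemma measurableSet_window (z : Microstate) (n : ℕ) : MeasurableSet (window z n) := by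
  have : window z n = ⋂ i ∈ sites n, {w : Microstate | w.1 i = z.1 i ∧ w.2 i = z.2 i} := by
    rw [window_eq]; ext w; simp
  rw [this]
  refine Finset.measurableSet_biInter _ fun i _ => ?_
  exact (measurableSet_eq_fun ((measurable_pi_apply i).comp measurable_fst) measurable_const).inter
    (measurableSet_eq_fun ((measurable_pi_apply i).comp measurable_snd) measurable_const)

lemma map_bernoulliConfig (p : ℝ) (e : ℤ ≃ ℤ) :
    MeasurePreserving (fun (x : Config) i => x (e i)) (bernoulliConfig p) (bernoulliConfig p) := by
  refine ⟨measurable_pi_lambda _ fun i => measurable_pi_apply _, ?_⟩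
  exact Measure.map_infinitePi_infinitePi_of_inj (P := fun _ : ℤ => bernoulliBool p) e.injective

lemma map_gibbs (m : ℝ × ℝ) (e f : ℤ ≃ ℤ) :
    MeasurePreserving (fun (w : Microstate) => ((fun i => w.1 (e i), fun i => w.2 (f i)) : Microstate))
      (gibbs m) (gibbs m) :=
  (map_bernoulliConfig _ e).prod (map_bernoulliConfig _ f)

/-- The spins are translated by `t` while the scatterers stay in place; this is allowed because
`gibbs` is invariant under separate permutations of the two lattices. -/
lemma map_phi_window (m : ℝ × ℝ) (t n : ℕ) (z : Microstate) :
    (gibbs m).map phi^[t] (window (phi^[t] z) n) =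
      gibbs m (event (sites n) (-t) t (fun i => z.1 (i - t)) z.2) := by
  rw [Measure.map_apply (measurable_phi_iterate t) (measurableSet_window _ _)]
  rw [← (map_gibbs m (Equiv.subRight (t : ℤ)) (Equiv.refl ℤ)).measure_preimage
    (measurableSet_event _ _ _ _ _).nullMeasurableSet]
  congr 1
  ext w
  simp only [Set.mem_preimage, window_eq, phi_iterate, event, Set.mem_ofPred_eq,
    Equiv.subRight_apply, Equiv.refl_apply]
  refine forall₂_congr fun i _ => and_congr_left fun _ => ?_
  rw [← sub_eq_add_neg]
  generalize w.1 (i - t) = a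
  generalize z.1 (i - t) = b
  generalize parity z.2 (i - t) t = c
  have : (fun i => w.2 i) = w.2 := rfl
  rw [this]
  generalize parity w.2 (i - t) t = d
  revert a b c d
  decide

/-- Spins and scatterers are reflected back to the sites of the window. The evolved spin of `z` at
`i` carries the parity of the `t` scatterers before `i`; the initial spin that produces it through
the reflected scatterers also carries the parity of the `t` scatterers from `i` on. Together these
are the `2 * t` scatterers from `i - t` on. -/
lemma map_phi_reversal_window (m : ℝ × ℝ) (t n : ℕ) (z : Microstate) :
    (gibbs m).map phi^[t] (reversal '' window (phi^[t] z) n) =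
      gibbs m (event (sites n) 0 t
        (fun i => xor (z.1 (i - t)) (parity z.2 (i - t) (2 * t))) z.2) := by
  rw [reversal_image, Measure.map_apply (measurable_phi_iterate t)
    (measurable_reversal (measurableSet_window _ _))]
  rw [← (map_gibbs m ((Equiv.neg ℤ).trans (Equiv.subRight (t : ℤ)))
    ((Equiv.neg ℤ).trans (Equiv.subRight (1 : ℤ)))).measure_preimage
    (measurableSet_event _ _ _ _ _).nullMeasurableSet]
  congr 1
  ext w
  simp only [Set.mem_preimage, window_eq, phi_iterate, event, Set.mem_ofPred_eq, reversal,
    Equiv.subRight_apply, Equiv.neg_apply, Equiv.trans_apply, add_zero]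
  refine forall₂_congr fun i _ => and_congr_left fun _ => ?_
  rw [parity_reflect, two_mul, parity_add, sub_add_cancel]
  generalize w.1 (-i - t) = a
  generalize z.1 (i - t) = b
  generalize parity z.2 (i - t) t = c
  generalize parity w.2 (-i - t) t = d
  generalize parity z.2 i t = f
  revert a b c d f
  decide

/-! ### Probabilities of the events -/

section

variable {m : ℝ × ℝ}

lemma gibbs_event (h0 : m.1 ∈ Set.Icc (-1 : ℝ) 1) (W : Finset ℤ) (c : ℤ) (t : ℕ) (X Y : Config) :
    gibbs m (event W c t X Y) = ∫⁻ y in {y | ∀ i ∈ W, y i = Y i},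
      ENNReal.ofReal (∏ i ∈ W, weight ((1 + m.1) / 2)
        (xor (X i) (xor (parity Y (i + c) t) (parity y (i + c) t)))) ∂bernoulliConfig m.2 := by
  rw [gibbs, Measure.prod_apply_symm (measurableSet_event _ _ _ _ _),
    ← lintegral_indicator (measurableSet_cylinder W Y)]
  refine lintegral_congr fun y => ?_
  by_cases hy : y ∈ {y : Config | ∀ i ∈ W, y i = Y i}
  · rw [Set.indicator_of_mem hy, ← bernoulliConfig_cylinder (prob_mem h0)]
    congr 1
    ext x
    simp only [event, Set.mem_preimage, Set.mem_ofPred_eq]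
    exact forall₂_congr fun i hi => and_iff_left (hy i hi)
  · rw [Set.indicator_of_notMem hy]
    convert measure_empty (μ := bernoulliConfig ((1 + m.1) / 2))
    refine Set.eq_empty_of_forall_notMem fun x hx => hy fun i hi => ?_
    exact (hx i hi).2

lemma gibbs_event_of_ae (h0 : m.1 ∈ Set.Icc (-1 : ℝ) 1) (h1 : m.2 ∈ Set.Icc (0 : ℝ) 1)
    (W : Finset ℤ) (c : ℤ) (t : ℕ) (X Y : Config)
    (h : ∀ᵐ y ∂bernoulliConfig m.2, ∀ i ∈ W, parity Y (i + c) t = parity y (i + c) t) :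
    gibbs m (event W c t X Y) =
      ENNReal.ofReal (∏ i ∈ W, weight ((1 + m.1) / 2) (X i)) *
        ENNReal.ofReal (∏ i ∈ W, weight m.2 (Y i)) := by
  rw [gibbs_event h0, lintegral_congr_ae (g := fun _ => ENNReal.ofReal
    (∏ i ∈ W, weight ((1 + m.1) / 2) (X i))) ?_, setLIntegral_const, bernoulliConfig_cylinder h1]
  filter_upwards [ae_restrict_of_ae h] with y hy
  congr 1
  refine Finset.prod_congr rfl fun i hi => ?_
  rw [hy i hi, Bool.xor_self, Bool.xor_false]

/-- `E` contains the sites of `W` whose `t` relevant scatterers may leave `W`. Elsewhere the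
parities of `y` and `Y` agree on the cylinder, so the integrand of `gibbs_event` differs from `∏
weight (X i)` in at most `t` factors, each between `r` and `1`. -/
lemma gibbs_event_bounds (h0 : m.1 ∈ Set.Icc (-1 : ℝ) 1) (h1 : m.2 ∈ Set.Icc (0 : ℝ) 1)
    {r : ℝ} (hr : 0 < r) (hr1 : r ≤ 1) (hrw : ∀ b, r ≤ weight ((1 + m.1) / 2) b)
    (W E : Finset ℤ) {c : ℤ} {t : ℕ} (hE : E.card ≤ t)
    (hWE : ∀ i ∈ W, i ∉ E → ∀ a, i + c ≤ a → a < i + c + t → a ∈ W) (X Y : Config) :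
    r ^ t * ((∏ i ∈ W, weight ((1 + m.1) / 2) (X i)) * ∏ i ∈ W, weight m.2 (Y i)) ≤
        (gibbs m (event W c t X Y)).toReal ∧
    r ^ t * (gibbs m (event W c t X Y)).toReal ≤
      (∏ i ∈ W, weight ((1 + m.1) / 2) (X i)) * ∏ i ∈ W, weight m.2 (Y i) := by
  set p := (1 + m.1) / 2 with hp
  have hpm : p ∈ Set.Icc (0 : ℝ) 1 := prob_mem h0
  set cyl : Set Config := {y | ∀ i ∈ W, y i = Y i} with hcyl
  have hcylm : MeasurableSet cyl := measurableSet_cylinder W Y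
  have hν : bernoulliConfig m.2 cyl = ENNReal.ofReal (∏ i ∈ W, weight m.2 (Y i)) :=
    bernoulliConfig_cylinder h1 W Y
  set P := ∏ i ∈ W, weight p (X i) with hP
  set Q := ∏ i ∈ W, weight m.2 (Y i) with hQ
  have hP0 : 0 ≤ P := Finset.prod_nonneg fun i _ => weight_nonneg hpm _
  have hQ0 : 0 ≤ Q := Finset.prod_nonneg fun i _ => weight_nonneg h1 _
  -- Symmetric in `u` and `v`, so it serves for both the lower and the upper bound.
  have hfac : ∀ u v : ℤ → Bool, (∀ i ∈ W, i ∉ E → u i = v i) →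
      r ^ t * ∏ i ∈ W, weight p (u i) ≤ ∏ i ∈ W, weight p (v i) := by
    intro u v huv
    have hu0 : 0 ≤ ∏ i ∈ W, weight p (u i) := Finset.prod_nonneg fun i _ => weight_nonneg hpm _
    calc r ^ t * ∏ i ∈ W, weight p (u i)
        ≤ (∏ i ∈ W, if i ∈ E then r else 1) * ∏ i ∈ W, weight p (u i) := by
          refine mul_le_mul_of_nonneg_right ?_ hu0
          rw [Finset.prod_ite, Finset.prod_const, Finset.prod_const_one, mul_one]
          refine pow_le_pow_of_le_one hr.le hr1 (le_trans ?_ hE)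
          exact Finset.card_le_card fun i hi => (Finset.mem_filter.1 hi).2
      _ = ∏ i ∈ W, (if i ∈ E then r else 1) * weight p (u i) := by rw [Finset.prod_mul_distrib]
      _ ≤ _ := by
          refine Finset.prod_le_prod (fun i _ => mul_nonneg (by split_ifs <;> positivity)
            (weight_nonneg hpm _)) fun i hi => ?_
          split_ifs with hiE
          · exact (mul_le_of_le_one_right hr.le (weight_le_one hpm _)).trans (hrw _)
          · rw [one_mul, huv i hi hiE]
  have hagree : ∀ y ∈ cyl, ∀ i ∈ W, i ∉ E →
      xor (X i) (xor (parity Y (i + c) t) (parity y (i + c) t)) = X i := by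
    intro y hy i hi hiE
    have : parity y (i + c) t = parity Y (i + c) t :=
      parity_congr fun a ha ha' => hy a (hWE i hi hiE a ha ha')
    rw [this, Bool.xor_self, Bool.xor_false]
  have hev := gibbs_event (m := m) h0 W c t X Y
  have hrt : 0 < r ^ t := by positivity
  have hlow : ENNReal.ofReal (r ^ t * (P * Q)) ≤ gibbs m (event W c t X Y) := by
    rw [hev, ← mul_assoc, ENNReal.ofReal_mul (by positivity), ← hν, ← setLIntegral_const]
    refine setLIntegral_mono' hcylm fun y hy => ENNReal.ofReal_le_ofReal ?_
    exact hfac _ _ fun i hi hiE => (hagree y hy i hi hiE).symm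
  have hup : gibbs m (event W c t X Y) ≤ ENNReal.ofReal ((r ^ t)⁻¹ * (P * Q)) := by
    rw [hev, ← mul_assoc, ENNReal.ofReal_mul (by positivity), ← hν, ← setLIntegral_const]
    refine setLIntegral_mono' hcylm fun y hy => ENNReal.ofReal_le_ofReal ?_
    rw [← mul_le_mul_iff_right₀ hrt, ← mul_assoc, mul_inv_cancel₀ hrt.ne', one_mul]
    exact hfac _ _ fun i hi hiE => hagree y hy i hi hiE
  constructor
  · exact (ENNReal.ofReal_le_iff_le_toReal (measure_ne_top _ _)).1 hlow
  · have := ENNReal.toReal_le_of_le_ofReal (by positivity) hup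
    calc _ ≤ r ^ t * ((r ^ t)⁻¹ * (P * Q)) := mul_le_mul_of_nonneg_left this hrt.le
      _ = _ := by rw [← mul_assoc, mul_inv_cancel₀ hrt.ne', one_mul]

/-! ### Positivity for random microstates -/

lemma gibbs_agree_ne_zero {z : Microstate} (hz : IsMLRandomState (gibbs m) z) (F : Finset ℤ) :
    gibbs m {w | ∀ i ∈ F, w.1 i = z.1 i ∧ w.2 i = z.2 i} ≠ 0 := by
  choose k hk using exists_site_eq
  set N := ∑ i ∈ F, (2 * k i + 2) with hN
  have h := hz.cylinder_pos N
  have hmeas : MeasurableSet (cylinder (prefixList (code z) N)) := by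
    have : cylinder (prefixList (code z) N) = (Set.Iio N).pi fun i => {code z i} := by
      ext u; simp [cylinder, prefixList, Set.mem_pi]
    rw [this]
    exact MeasurableSet.pi (Set.to_countable _) fun i _ => measurableSet_singleton _
  rw [Measure.map_apply measurable_code hmeas] at h
  have hsub : code ⁻¹' cylinder (prefixList (code z) N) ⊆
      {w | ∀ i ∈ F, w.1 i = z.1 i ∧ w.2 i = z.2 i} := ?_
  · exact fun h2 => h (measure_mono_null hsub h2)
  intro w hw i hi
  have hle : 2 * k i + 2 ≤ N :=
    Finset.single_le_sum (f := fun i => 2 * k i + 2) (fun _ _ => Nat.zero_le _) hi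
  have hc : ∀ j < N, code w j = code z j := by
    intro j hj
    have := hw j (by simpa [prefixList] using hj)
    simpa [prefixList] using this
  have e1 := hc (2 * k i) (by omega)
  have e2 := hc (2 * k i + 1) (by omega)
  rw [code_even, code_even, hk] at e1
  rw [code_odd, code_odd, hk] at e2
  exact ⟨e1, e2⟩

lemma weight_ne_zero (h0 : m.1 ∈ Set.Icc (-1 : ℝ) 1) (h1 : m.2 ∈ Set.Icc (0 : ℝ) 1)
    {z : Microstate} (hz : IsMLRandomState (gibbs m) z) (i : ℤ) :
    weight ((1 + m.1) / 2) (z.1 i) ≠ 0 ∧ weight m.2 (z.2 i) ≠ 0 := by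
  have h := gibbs_agree_ne_zero hz {i}
  have e : {w : Microstate | ∀ j ∈ ({i} : Finset ℤ), w.1 j = z.1 j ∧ w.2 j = z.2 j} =
      {x : Config | ∀ j ∈ ({i} : Finset ℤ), x j = z.1 j} ×ˢ
        {y : Config | ∀ j ∈ ({i} : Finset ℤ), y j = z.2 j} := by
    ext w; simp
  rw [e, gibbs, Measure.prod_prod, bernoulliConfig_cylinder (prob_mem h0),
    bernoulliConfig_cylinder h1] at h
  constructor <;> intro h2 <;> apply h <;> simp [h2]

lemma map_phi_window_ne_zero {z : Microstate} (hz : IsMLRandomState (gibbs m) z) (t n : ℕ) :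
    (gibbs m).map phi^[t] (window (phi^[t] z) n) ≠ 0 := by
  rw [Measure.map_apply (measurable_phi_iterate t) (measurableSet_window _ _)]
  refine fun h => gibbs_agree_ne_zero hz (Finset.Icc (-(n + t : ℤ)) (n + t)) (measure_mono_null ?_ h)
  intro w hw
  have hw' : ∀ i, -(n + t : ℤ) ≤ i → i ≤ n + t → w.1 i = z.1 i ∧ w.2 i = z.2 i :=
    fun i ha hb => hw i (Finset.mem_Icc.2 ⟨ha, hb⟩)
  simp only [Set.mem_preimage, window_eq, phi_iterate, Set.mem_ofPred_eq]
  intro i hi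
  rw [mem_sites] at hi
  have hpar : parity w.2 (i - t) t = parity z.2 (i - t) t :=
    parity_congr fun a ha ha' => (hw' a (by omega) (by omega)).2
  rw [hpar, (hw' (i - t) (by omega) (by omega)).1]
  exact ⟨rfl, (hw' i (by omega) (by omega)).2⟩

end

/-! ### The rate of irreversible information loss -/

section

variable {m : ℝ × ℝ}

lemma eq_of_weight_ne_zero {p : ℝ} (hp : p = 0 ∨ p = 1) {a b : Bool} (ha : weight p a ≠ 0)
    (hb : weight p b ≠ 0) : a = b := by
  rcases hp with rfl | rfl <;> cases a <;> cases b <;> simp [weight] at ha hb ⊢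

lemma ae_eq_of_deterministic (h1 : m.2 = 0 ∨ m.2 = 1) {Y : Config}
    (hY : ∀ i, weight m.2 (Y i) ≠ 0) : ∀ᵐ y ∂bernoulliConfig m.2, y = Y := by
  have hm : m.2 ∈ Set.Icc (0 : ℝ) 1 := by rcases h1 with h | h <;> rw [h] <;> simp
  have : ∀ᵐ y ∂bernoulliConfig m.2, ∀ i, y i = Y i := by
    rw [ae_all_iff]
    intro i
    have h := bernoulliConfig_cylinder hm {i} fun j => !(Y j)
    have hw : weight m.2 (!(Y i)) = 0 := by
      by_contra hne
      have := eq_of_weight_ne_zero h1 hne (hY i)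
      simp at this
    rw [Finset.prod_singleton, hw, ENNReal.ofReal_zero] at h
    rw [ae_iff]
    convert h using 2
    ext y
    simp [Bool.eq_not]
  filter_upwards [this] with y hy
  exact funext hy

/-- For `m₁ ∈ {0, 1}` the scatterers are almost surely constant: two adjacent ranges of length `t`
have equal parity and cancel, and the parity corrections in `event` vanish. For `t = 0` all parities
are empty. -/
lemma map_phi_reversal_window_eq (h0 : m.1 ∈ Set.Icc (-1 : ℝ) 1) (h1 : m.2 ∈ Set.Icc (0 : ℝ) 1)
    {z : Microstate} (hz : IsMLRandomState (gibbs m) z) {t : ℕ}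
    (ht : t = 0 ∨ m.2 = 0 ∨ m.2 = 1) (n : ℕ) :
    (gibbs m).map phi^[t] (reversal '' window (phi^[t] z) n) =
      (gibbs m).map phi^[t] (window (phi^[t] z) n) := by
  rw [map_phi_reversal_window, map_phi_window]
  have hX : ∀ i, xor (z.1 (i - t)) (parity z.2 (i - t) (2 * t)) = z.1 (i - t) := by
    intro i
    rcases ht with rfl | ht
    · simp [parity]
    · have hc : parity z.2 (i - t) t = parity z.2 (i - t + t) t := by
        refine sgn_injective ?_
        have hall : ∀ a, z.2 a = z.2 0 := fun a => eq_of_weight_ne_zero ht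
          (weight_ne_zero h0 h1 hz a).2 (weight_ne_zero h0 h1 hz 0).2
        rw [sgn_parity, sgn_parity]
        simp [hall]
      rw [two_mul, parity_add, ← hc, Bool.xor_self, Bool.xor_false]
  have hae : ∀ᵐ y ∂bernoulliConfig m.2, ∀ c i : ℤ, parity z.2 (i + c) t = parity y (i + c) t := by
    rcases ht with rfl | ht
    · exact ae_of_all _ fun y c i => rfl
    · filter_upwards [ae_eq_of_deterministic ht fun i => (weight_ne_zero h0 h1 hz i).2] with y hy
      intro c i
      rw [hy]
  rw [gibbs_event_of_ae h0 h1 _ _ _ _ _ (hae.mono fun y hy i _ => hy _ i),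
    gibbs_event_of_ae h0 h1 _ _ _ _ _ (hae.mono fun y hy i _ => hy _ i)]
  simp only [hX]

lemma infoLoss_eq_zero (h0 : m.1 ∈ Set.Icc (-1 : ℝ) 1) (h1 : m.2 ∈ Set.Icc (0 : ℝ) 1)
    {z : Microstate} (hz : IsMLRandomState (gibbs m) z) {t : ℕ}
    (ht : t = 0 ∨ m.2 = 0 ∨ m.2 = 1) : infoLoss (gibbs m) t z = 0 := by
  have : IsProbabilityMeasure ((gibbs m).map phi^[t]) :=
    Measure.isProbabilityMeasure_map (measurable_phi_iterate t).aemeasurable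
  rw [infoLoss]
  simp_rw [map_phi_reversal_window_eq h0 h1 hz ht,
    ENNReal.div_self (map_phi_window_ne_zero hz t _) (measure_ne_top _ _), ENNReal.log_one, mul_zero]
  exact limsup_const 0

lemma gibbs_event_eq_zero (h0 : m.1 ∈ Set.Icc (-1 : ℝ) 1) {W : Finset ℤ} {c : ℤ} {t : ℕ}
    {X Y : Config} {i : ℤ} (hW : ∀ a, i + c ≤ a → a < i + c + t → a ∈ W) (hi : i ∈ W)
    (hX : weight ((1 + m.1) / 2) (X i) = 0) : gibbs m (event W c t X Y) = 0 := by
  have hsub : event W c t X Y ⊆ {x : Config | ∀ j ∈ ({i} : Finset ℤ), x j = X j} ×ˢ Set.univ := by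
    intro w hw
    refine ⟨fun j hj => ?_, trivial⟩
    rw [Finset.mem_singleton.1 hj]
    have hpar : parity w.2 (i + c) t = parity Y (i + c) t :=
      parity_congr fun a ha ha' => (hw a (hW a ha ha')).2
    have := (hw i hi).1
    rwa [hpar, Bool.xor_self, Bool.xor_false] at this
  refine measure_mono_null hsub ?_
  rw [gibbs, Measure.prod_prod, bernoulliConfig_cylinder (prob_mem h0)]
  simp [hX]

lemma infoLoss_eq_top (h0 : m.1 = -1 ∨ m.1 = 1) (h1 : m.2 ∈ Set.Ioo (0 : ℝ) 1)
    {z : Microstate} (hz : IsMLRandomState (gibbs m) z) {t : ℕ} (ht : 0 < t) :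
    infoLoss (gibbs m) t z = ⊤ := by
  have h0' : m.1 ∈ Set.Icc (-1 : ℝ) 1 := by rcases h0 with h | h <;> rw [h] <;> simp
  have h1' : m.2 ∈ Set.Icc (0 : ℝ) 1 := ⟨h1.1.le, h1.2.le⟩
  have hp : (1 + m.1) / 2 = 0 ∨ (1 + m.1) / 2 = 1 := by
    rcases h0 with h | h <;> rw [h] <;> norm_num
  -- For `|m₀| = 1` only one spin value is possible. If every prescribed spin were possible, `block
  -- (2 * t)` would be constant on the sites `j ≥ 0`, with averages of modulus `1`, whereas they
  -- tend to a limit of modulus `|1 - 2 m₁| ^ (2 t) < 1`.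
  obtain ⟨i, hi⟩ : ∃ i : ℤ, weight ((1 + m.1) / 2)
      (xor (z.1 (i - t)) (parity z.2 (i - t) (2 * t))) = 0 := by
    by_contra! hne
    have hb : ∀ j : ℕ, block (2 * t) z j = sgn (z.1 0) := by
      intro j
      rw [block_eq_sgn]
      congr 1
      have := hne (j + t)
      rw [add_sub_cancel_right] at this
      exact eq_of_weight_ne_zero hp this (weight_ne_zero h0' h1' hz 0).1
    have hlim := tendsto_block_pos h0' h1' hz (2 * t)
    have hlim2 : Tendsto (fun N : ℕ => (∑ j ∈ Finset.range N, block (2 * t) z j) / N) atTop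
        (𝓝 (sgn (z.1 0))) := by
      refine tendsto_const_nhds.congr' ?_
      filter_upwards [eventually_gt_atTop 0] with N hN
      have : (N : ℝ) ≠ 0 := by positivity
      simp only [hb, Finset.sum_const, Finset.card_range, nsmul_eq_mul]
      field_simp
    have heq := congrArg (|·|) (tendsto_nhds_unique hlim hlim2)
    have hm : |m.1| = 1 := by rcases h0 with h | h <;> rw [h] <;> norm_num
    simp only [blockMean, abs_mul, abs_neg, hm, abs_sgn, one_mul, abs_pow] at heq
    have hlt : |1 - 2 * m.2| < 1 := abs_lt.2 ⟨by linarith [h1.2], by linarith [h1.1]⟩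
    exact absurd heq (pow_lt_one₀ (abs_nonneg _) hlt (by omega)).ne
  rw [infoLoss]
  refine (limsup_congr (v := fun _ => (⊤ : EReal)) ?_).trans (limsup_const _)
  -- From this length on the window contains `i` and the scatterers `i, …, i + t - 1`, so the
  -- impossible spin is really forced and the numerator vanishes.
  filter_upwards [eventually_ge_atTop (2 * (i.natAbs + t) + 2)] with n hn
  have hnum : (gibbs m).map phi^[t] (reversal '' window (phi^[t] z) n) = 0 := by
    rw [map_phi_reversal_window]
    refine gibbs_event_eq_zero h0' (i := i) (fun a ha ha' => ?_) ?_ hi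
    · rw [mem_sites]; omega
    · rw [mem_sites]; omega
  have hn0 : (0 : ℝ) < n := by exact_mod_cast (by omega)
  rw [hnum, ENNReal.zero_div, ENNReal.log_zero]
  exact EReal.coe_mul_bot_of_neg (by rw [neg_lt_zero]; positivity)

lemma log_weight (p : ℝ) (b : Bool) :
    Real.log (weight p b) = (Real.log p + Real.log (1 - p)) / 2 +
      (Real.log (1 - p) - Real.log p) / 2 * sgn b := by
  cases b <;> simp [weight, sgn] <;> ring

/-- The logarithm of the probability of an event, up to a bounded error. -/
lemma abs_log_gibbs_event_sub_le (h0 : m.1 ∈ Set.Ioo (-1 : ℝ) 1) (h1 : m.2 ∈ Set.Icc (0 : ℝ) 1)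
    (t : ℕ) : ∃ C : ℝ, ∀ (W E : Finset ℤ) (c : ℤ), E.card ≤ t →
    (∀ i ∈ W, i ∉ E → ∀ a, i + c ≤ a → a < i + c + t → a ∈ W) → ∀ X Y : Config,
    (∀ i, weight m.2 (Y i) ≠ 0) →
    0 < (gibbs m (event W c t X Y)).toReal ∧
    |Real.log (gibbs m (event W c t X Y)).toReal -
      (∑ i ∈ W, Real.log (weight ((1 + m.1) / 2) (X i)) +
        ∑ i ∈ W, Real.log (weight m.2 (Y i)))| ≤ C := by
  have h0' : m.1 ∈ Set.Icc (-1 : ℝ) 1 := ⟨h0.1.le, h0.2.le⟩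
  set p := (1 + m.1) / 2 with hp
  have hp0 : 0 < p := by rw [hp]; linarith [h0.1]
  have hp1 : 0 < 1 - p := by rw [hp]; linarith [h0.2]
  have hw : ∀ b, 0 < weight p b := by
    intro b
    cases b
    exacts [hp1, hp0]
  set r := min p (1 - p) with hr
  have hr0 : 0 < r := lt_min hp0 hp1
  have hr1 : r ≤ 1 := (min_le_left _ _).trans (by linarith)
  have hrw : ∀ b, r ≤ weight p b := by
    intro b; cases b <;> simp [weight, hr]
  refine ⟨-(t * Real.log r), fun W E c hE hWE X Y hY => ?_⟩
  obtain ⟨l, u⟩ := gibbs_event_bounds h0' h1 hr0 hr1 hrw W E hE hWE X Y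
  have hY' : ∀ i, 0 < weight m.2 (Y i) := fun i => lt_of_le_of_ne (weight_nonneg h1 _) (hY i).symm
  have hP : 0 < ∏ i ∈ W, weight p (X i) := Finset.prod_pos fun i _ => hw _
  have hQ : 0 < ∏ i ∈ W, weight m.2 (Y i) := Finset.prod_pos fun i _ => hY' _
  have hrt : 0 < r ^ t := by positivity
  have hpos := lt_of_lt_of_le (mul_pos hrt (mul_pos hP hQ)) l
  refine ⟨hpos, ?_⟩
  have l' := Real.log_le_log (mul_pos hrt (mul_pos hP hQ)) l
  have u' := Real.log_le_log (mul_pos hrt hpos) u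
  rw [Real.log_mul hrt.ne' (mul_pos hP hQ).ne'] at l'
  rw [Real.log_mul hrt.ne' hpos.ne'] at u'
  rw [← Real.log_prod fun i _ => (hw _).ne', ← Real.log_prod fun i _ => (hY' i).ne',
    ← Real.log_mul hP.ne' hQ.ne', abs_le]
  rw [Real.log_pow] at l' u'
  constructor <;> linarith

lemma infoLoss_eq (h0 : m.1 ∈ Set.Ioo (-1 : ℝ) 1) (h1 : m.2 ∈ Set.Icc (0 : ℝ) 1)
    {z : Microstate} (hz : IsMLRandomState (gibbs m) z) (t : ℕ) :
    infoLoss (gibbs m) t z = (((1 - (1 - 2 * m.2) ^ (2 * t)) / 2 *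
      (m.1 * Real.log ((1 + m.1) / (1 - m.1))) : ℝ) : EReal) := by
  have h0' : m.1 ∈ Set.Icc (-1 : ℝ) 1 := ⟨h0.1.le, h0.2.le⟩
  obtain ⟨C, hC⟩ := abs_log_gibbs_event_sub_le h0 h1 t
  set p := (1 + m.1) / 2 with hp
  set B := (Real.log (1 - p) - Real.log p) / 2 with hB
  set X : Config := fun i => xor (z.1 (i - t)) (parity z.2 (i - t) (2 * t)) with hX
  set X' : Config := fun i => z.1 (i - t) with hX'
  set a : ℕ → ℝ := fun n => (gibbs m (event (sites n) 0 t X z.2)).toReal with ha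
  set b : ℕ → ℝ := fun n => (gibbs m (event (sites n) (-t) t X' z.2)).toReal with hb
  have hYw : ∀ i, weight m.2 (z.2 i) ≠ 0 := fun i => (weight_ne_zero h0' h1 hz i).2
  have hA : ∀ n, 0 < a n ∧ |Real.log (a n) - (∑ i ∈ sites n, Real.log (weight p (X i)) +
      ∑ i ∈ sites n, Real.log (weight m.2 (z.2 i)))| ≤ C := by
    intro n
    -- With `c = 0` the parities look to the right, so the exceptional sites are the last `t` of the
    -- window; with `c = -t` below, they look to the left and the first `t` are exceptional.
    refine hC (sites n) (Finset.Ico ((((n + 1) / 2 : ℕ) : ℤ) - t) ((n + 1) / 2 : ℕ)) 0 ?_ ?_ X z.2 hYw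
    · rw [Int.card_Ico]; omega
    · intro i hi hiE c hc hc'
      rw [mem_sites] at hi ⊢
      rw [Finset.mem_Ico] at hiE
      omega
  have hB' : ∀ n, 0 < b n ∧ |Real.log (b n) - (∑ i ∈ sites n, Real.log (weight p (X' i)) +
      ∑ i ∈ sites n, Real.log (weight m.2 (z.2 i)))| ≤ C := by
    intro n
    refine hC (sites n) (Finset.Ico (-((n / 2 : ℕ) : ℤ)) (-((n / 2 : ℕ) : ℤ) + t)) (-t) ?_ ?_ X' z.2
      hYw
    · rw [Int.card_Ico]; omega
    · intro i hi hiE c hc hc'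
      rw [mem_sites] at hi ⊢
      rw [Finset.mem_Ico] at hiE
      omega
  -- The scatterer weights are the same in both events and cancel; by `log_weight` the spin weights
  -- leave only sums of signs.
  have hdiff : ∀ n, ∑ i ∈ sites n, Real.log (weight p (X i)) -
      ∑ i ∈ sites n, Real.log (weight p (X' i)) =
      B * (∑ k ∈ Finset.range n, block (2 * t) z (site k - t) -
        ∑ k ∈ Finset.range n, block 0 z (site k - t)) := by
    intro n
    rw [← sum_sites (fun i => block (2 * t) z (i - t)), ← sum_sites (fun i => block 0 z (i - t)),
      ← Finset.sum_sub_distrib, ← Finset.sum_sub_distrib, Finset.mul_sum]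
    refine Finset.sum_congr rfl fun i _ => ?_
    rw [log_weight, log_weight, block_eq_sgn, block_eq_sgn, parity, Bool.xor_false]
    ring
  have hlim : Tendsto (fun n : ℕ => -(1 / (n : ℝ)) * (Real.log (a n) - Real.log (b n))) atTop
      (𝓝 (-(B * (blockMean m (2 * t) - blockMean m 0)))) := by
    have h2 := (((tendsto_average_block_site h0' h1 hz (le_refl (2 * t))).sub
      (tendsto_average_block_site h0' h1 hz (Nat.zero_le (2 * t)))).const_mul B).neg
    have h3 : Tendsto (fun n : ℕ => -(1 / (n : ℝ)) * (Real.log (a n) - Real.log (b n)) -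
        -(B * ((∑ k ∈ Finset.range n, block (2 * t) z (site k - t)) / n -
          (∑ k ∈ Finset.range n, block 0 z (site k - t)) / n))) atTop (𝓝 0) := by
      refine squeeze_zero_norm (a := fun n : ℕ => 2 * C / n) (fun n => ?_)
        (tendsto_const_div_atTop_nhds_zero_nat _)
      have e : -(1 / (n : ℝ)) * (Real.log (a n) - Real.log (b n)) -
        -(B * ((∑ k ∈ Finset.range n, block (2 * t) z (site k - t)) / n -
          (∑ k ∈ Finset.range n, block 0 z (site k - t)) / n)) =
          -((Real.log (a n) - Real.log (b n)) - (∑ i ∈ sites n, Real.log (weight p (X i)) -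
            ∑ i ∈ sites n, Real.log (weight p (X' i)))) / n := by
        rw [hdiff]; ring
      rw [e, Real.norm_eq_abs, abs_div, abs_neg, Nat.abs_cast]
      refine div_le_div_of_nonneg_right ?_ (Nat.cast_nonneg n)
      have u1 := abs_le.1 (hA n).2
      have u2 := abs_le.1 (hB' n).2
      rw [abs_le]
      constructor <;> linarith [u1.1, u1.2, u2.1, u2.2]
    have := h3.add h2
    rw [zero_add] at this
    exact this.congr fun n => by ring
  have hval : -(B * (blockMean m (2 * t) - blockMean m 0)) =
      (1 - (1 - 2 * m.2) ^ (2 * t)) / 2 * (m.1 * Real.log ((1 + m.1) / (1 - m.1))) := by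
    have q1 : 0 < 1 + m.1 := by linarith [h0.1]
    have q2 : 0 < 1 - m.1 := by linarith [h0.2]
    have e : 1 - p = (1 - m.1) / 2 := by rw [hp]; ring
    rw [hB, e, hp, Real.log_div q1.ne' two_ne_zero, Real.log_div q2.ne' two_ne_zero,
      Real.log_div q1.ne' q2.ne', blockMean, blockMean, pow_zero]
    ring
  rw [infoLoss, ← hval]
  refine Tendsto.limsup_eq (((continuous_coe_real_ereal.tendsto _).comp hlim).congr fun n => ?_)
  have ea : (gibbs m).map phi^[t] (reversal '' window (phi^[t] z) n) = ENNReal.ofReal (a n) := by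
    rw [map_phi_reversal_window, ha, ENNReal.ofReal_toReal (measure_ne_top _ _)]
  have eb : (gibbs m).map phi^[t] (window (phi^[t] z) n) = ENNReal.ofReal (b n) := by
    rw [map_phi_window, hb, ENNReal.ofReal_toReal (measure_ne_top _ _)]
  rw [ea, eb, ← ENNReal.ofReal_div_of_pos (hB' n).1,
    ENNReal.log_ofReal_of_pos (div_pos (hA n).1 (hB' n).1),
    Real.log_div (hA n).1.ne' (hB' n).1.ne', ← EReal.coe_mul]
  rfl

end

/-! ### Comparison with the Boltzmann entropy -/

lemma Phi_iterate (m : ℝ × ℝ) (t : ℕ) : Phi^[t] m = ((1 - 2 * m.2) ^ t * m.1, m.2) := by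
  induction t with
  | zero => simp
  | succ t ih =>
    rw [Function.iterate_succ_apply', ih, Phi]
    refine Prod.ext ?_ rfl
    ring

/-- Gibbs' inequality for Bernoulli distributions. -/
lemma binEntropy_lt_cross {a p : ℝ} (ha : a ∈ Set.Icc (0 : ℝ) 1) (hp : p ∈ Set.Ioo (0 : ℝ) 1)
    (hap : a ≠ p) :
    Real.binEntropy a < -(a * Real.log p + (1 - a) * Real.log (1 - p)) := by
  -- From `log u < u - 1` at `u = q / x ≠ 1`. Applied to `(a, p)` and `(1 - a, 1 - p)`, the
  -- right-hand sides add up to `0`.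
  have key : ∀ x q : ℝ, 0 ≤ x → 0 < q → x ≠ q → x.negMulLog + x * Real.log q < q - x := by
    intro x q hx hq hne
    rcases hx.eq_or_lt with rfl | hx
    · simpa using hq
    · have h1 := Real.log_lt_sub_one_of_pos (div_pos hq hx) (by
        rw [Ne, div_eq_one_iff_eq hx.ne']; exact hne.symm)
      rw [Real.log_div hq.ne' hx.ne'] at h1
      have h2 := mul_lt_mul_of_pos_left h1 hx
      rw [mul_sub, mul_sub, mul_div_cancel₀ _ hx.ne'] at h2
      rw [Real.negMulLog]
      linarith
  have k1 := key a p ha.1 hp.1 hap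
  have k2 := key (1 - a) (1 - p) (by linarith [ha.2]) (by linarith [hp.2])
    (fun h => hap (by linarith))
  rw [Real.binEntropy_eq_negMulLog_add_negMulLog_one_sub]
  linarith

lemma binEntropy_abs_mul (r x : ℝ) :
    Real.binEntropy ((1 + r * x) / 2) = Real.binEntropy ((1 + |r| * x) / 2) := by
  rcases abs_choice r with h | h
  · rw [h]
  · rw [h, ← Real.binEntropy_one_sub]
    congr 1
    ring

lemma mul_log_div_pos {x : ℝ} (hx : x ∈ Set.Ioo (-1 : ℝ) 1) (hx0 : x ≠ 0) :
    0 < x * Real.log ((1 + x) / (1 - x)) := by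
  have h2 : 0 < 1 - x := by linarith [hx.2]
  rcases lt_or_gt_of_ne hx0 with h | h
  · refine mul_pos_of_neg_of_neg h (Real.log_neg (div_pos (by linarith [hx.1]) h2) ?_)
    rw [div_lt_one h2]; linarith
  · refine mul_pos h (Real.log_pos ?_)
    rw [one_lt_div h2]; linarith

/-- Put `s = |r|`, `a = (1 + s x) / 2` and `p = (1 + x) / 2`. Gibbs' inequality bounds the
difference by `(p - a) * log (p / (1 - p))`, which is `(1 - s) / 2` times `x * log ((1 + x) / (1 -
x))`. Then `1 - s ≤ 1 - s ^ 2`; this needs `s ≥ 0`, whence the passage to `|r|` by the symmetry of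
the entropy. -/
lemma binEntropy_sub_lt {x r : ℝ} (hx : x ∈ Set.Ioo (-1 : ℝ) 1) (hx0 : x ≠ 0) (hr : |r| < 1) :
    Real.binEntropy ((1 + r * x) / 2) - Real.binEntropy ((1 + x) / 2) <
      (1 - r ^ 2) / 2 * (x * Real.log ((1 + x) / (1 - x))) := by
  have q1 : 0 < 1 + x := by linarith [hx.1]
  have q2 : 0 < 1 - x := by linarith [hx.2]
  have hs0 := abs_nonneg r
  rw [binEntropy_abs_mul, ← sq_abs r]
  generalize |r| = s at hr hs0
  have hmem : (1 + s * x) / 2 ∈ Set.Icc (0 : ℝ) 1 := by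
    constructor <;> nlinarith [hx.1, hx.2]
  have hpm : (1 + x) / 2 ∈ Set.Ioo (0 : ℝ) 1 := by constructor <;> linarith
  have hne : (1 + s * x) / 2 ≠ (1 + x) / 2 := by
    intro h
    have : (1 - s) * x = 0 := by linarith
    rcases mul_eq_zero.1 this with h | h
    · linarith
    · exact hx0 h
  have hg := binEntropy_lt_cross hmem hpm hne
  have hpos := mul_log_div_pos hx hx0
  have e0 : Real.binEntropy ((1 + x) / 2) = -((1 + x) / 2 * Real.log ((1 + x) / 2) +
      (1 - (1 + x) / 2) * Real.log (1 - (1 + x) / 2)) := by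
    rw [Real.binEntropy_eq_negMulLog_add_negMulLog_one_sub, Real.negMulLog, Real.negMulLog]; ring
  have e1 : Real.log ((1 + x) / (1 - x)) =
      Real.log ((1 + x) / 2) - Real.log (1 - (1 + x) / 2) := by
    rw [show 1 - (1 + x) / 2 = (1 - x) / 2 by ring, ← Real.log_div (by positivity) (by positivity)]
    congr 1
    field_simp
  have h3 : Real.binEntropy ((1 + s * x) / 2) - Real.binEntropy ((1 + x) / 2) <
      (1 - s) / 2 * (x * Real.log ((1 + x) / (1 - x))) := by
    rw [e0, e1]
    linarith
  refine h3.trans_le (mul_le_mul_of_nonneg_right ?_ hpos.le)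
  nlinarith

end KacChain

/-! ### The theorem: degenerate and nondegenerate macrostates -/

theorem mainTheorem5 (m₀ m₁ : ℝ) (hm₀ : m₀ ∈ Set.Icc (-1 : ℝ) 1) (hm₁ : m₁ ∈ Set.Icc (0 : ℝ) 1)
    (hc₀ : KacChain.ComputableReal m₀) (hc₁ : KacChain.ComputableReal m₁)
    (z : KacChain.Microstate)
    (hz : KacChain.IsMLRandomState (KacChain.gibbs (m₀, m₁)) z) (t : ℕ) :
    (-1 < m₀ → m₀ < 1 →
      KacChain.infoLoss (KacChain.gibbs (m₀, m₁)) t z =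
        (((1 - (1 - 2 * m₁) ^ (2 * t)) / 2 * (m₀ * Real.log ((1 + m₀) / (1 - m₀))) : ℝ) : EReal)) ∧
    (m₀ ≠ 0 → m₁ ≠ 0 → m₁ ≠ 1 → 0 < t →
      0 < KacChain.infoLoss (KacChain.gibbs (m₀, m₁)) t z) ∧
    ∃ S₀ Sₜ : ℝ,
      KacChain.HasBoltzmannEntropy (m₀, m₁) (S₀ : EReal) ∧
      KacChain.HasBoltzmannEntropy (KacChain.Phi^[t] (m₀, m₁)) (Sₜ : EReal) ∧
      ((Sₜ - S₀ : ℝ) : EReal) ≤ KacChain.infoLoss (KacChain.gibbs (m₀, m₁)) t z ∧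
      (((Sₜ - S₀ : ℝ) : EReal) = KacChain.infoLoss (KacChain.gibbs (m₀, m₁)) t z ↔
        m₀ = 0 ∨ m₁ = 0 ∨ m₁ = 1 ∨ t = 0) := by
  have formula : -1 < m₀ → m₀ < 1 → _ := fun ha hb =>
    KacChain.infoLoss_eq (m := (m₀, m₁)) ⟨ha, hb⟩ hm₁ hz t
  have hr : |1 - 2 * m₁| ≤ 1 := abs_le.2 ⟨by linarith [hm₁.2], by linarith [hm₁.1]⟩
  have hr_lt : m₁ ≠ 0 → m₁ ≠ 1 → |1 - 2 * m₁| < 1 := by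
    intro h0 h1
    have h0 := lt_of_le_of_ne hm₁.1 h0.symm
    have h1 := lt_of_le_of_ne hm₁.2 h1
    exact abs_lt.2 ⟨by linarith, by linarith⟩
  have htop : ¬(-1 < m₀ ∧ m₀ < 1) → m₁ ≠ 0 → m₁ ≠ 1 → 0 < t →
      KacChain.infoLoss (KacChain.gibbs (m₀, m₁)) t z = ⊤ := by
    intro hm h0 h1 ht
    refine KacChain.infoLoss_eq_top (m := (m₀, m₁)) ?_
      ⟨lt_of_le_of_ne hm₁.1 h0.symm, lt_of_le_of_ne hm₁.2 h1⟩ hz ht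
    by_contra! hne
    exact hm ⟨lt_of_le_of_ne hm₀.1 hne.1.symm, lt_of_le_of_ne hm₀.2 hne.2⟩
  refine ⟨formula, ?_, ?_⟩
  · intro h0 hq0 hq1 ht
    by_cases hm : -1 < m₀ ∧ m₀ < 1
    · rw [formula hm.1 hm.2]
      refine EReal.coe_pos.2 (mul_pos (half_pos (sub_pos.2 ?_))
        (KacChain.mul_log_div_pos hm h0))
      rw [pow_mul]
      exact pow_lt_one₀ (sq_nonneg _) ((sq_lt_one_iff_abs_lt_one _).2 (hr_lt hq0 hq1)) ht.ne'
    · rw [htop hm hq0 hq1 ht]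
      exact EReal.zero_lt_top
  · have hmt : (1 - 2 * m₁) ^ t * m₀ ∈ Set.Icc (-1 : ℝ) 1 := by
      refine abs_le.1 ?_
      rw [abs_mul, abs_pow]
      exact mul_le_one₀ (pow_le_one₀ (abs_nonneg _) hr) (abs_nonneg _) (abs_le.2 hm₀)
    refine ⟨Real.binEntropy ((1 + m₀) / 2) + Real.binEntropy m₁ - 2 * Real.log 2,
      Real.binEntropy ((1 + (1 - 2 * m₁) ^ t * m₀) / 2) + Real.binEntropy m₁ - 2 * Real.log 2,
      KacChain.hasBoltzmannEntropy (m := (m₀, m₁)) hm₀ hm₁, ?_, ?_⟩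
    · rw [KacChain.Phi_iterate]
      exact KacChain.hasBoltzmannEntropy (m := ((1 - 2 * m₁) ^ t * m₀, m₁)) hmt hm₁
    have hS : Real.binEntropy ((1 + (1 - 2 * m₁) ^ t * m₀) / 2) + Real.binEntropy m₁ -
        2 * Real.log 2 - (Real.binEntropy ((1 + m₀) / 2) + Real.binEntropy m₁ - 2 * Real.log 2) =
        Real.binEntropy ((1 + (1 - 2 * m₁) ^ t * m₀) / 2) - Real.binEntropy ((1 + m₀) / 2) := by
      ring
    simp only [hS]
    by_cases hdeg : t = 0 ∨ m₁ = 0 ∨ m₁ = 1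
    · rw [KacChain.infoLoss_eq_zero (m := (m₀, m₁)) hm₀ hm₁ hz hdeg]
      -- The factor may be `-1`, which reverses the magnetization; the entropy does not see this
      -- sign.
      have habs : |(1 - 2 * m₁) ^ t| = 1 := by
        rw [abs_pow]
        rcases hdeg with rfl | rfl | rfl <;> norm_num
      rw [KacChain.binEntropy_abs_mul, habs, one_mul, sub_self]
      refine ⟨le_rfl, iff_of_true rfl ?_⟩
      tauto
    · push Not at hdeg
      obtain ⟨ht, hq0, hq1⟩ := hdeg
      have hlt : |(1 - 2 * m₁) ^ t| < 1 := by
        rw [abs_pow]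
        exact pow_lt_one₀ (abs_nonneg _) (hr_lt hq0 hq1) ht
      by_cases hm : -1 < m₀ ∧ m₀ < 1
      · rw [formula hm.1 hm.2]
        -- At `m₀ = 0` both the rate and the entropy gain vanish; otherwise the inequality is
        -- strict.
        by_cases h0 : m₀ = 0
        · subst h0
          simp
        · have := KacChain.binEntropy_sub_lt hm h0 hlt
          rw [← pow_mul, mul_comm t 2] at this
          have h2 := EReal.coe_lt_coe_iff.2 this
          exact ⟨h2.le, iff_of_false h2.ne (by tauto)⟩
      · rw [htop hm hq0 hq1 (Nat.pos_of_ne_zero ht)]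
        refine ⟨le_top, iff_of_false (EReal.coe_ne_top _) ?_⟩
        rintro (h | h | h | h)
        · exact hm (by rw [h]; norm_num)
        · exact hq0 h
        · exact hq1 h
        · exact ht h
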